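/- **Setting.** All quantum systems $A,B,E,R,\dots$ are finite-dimensional with nonzero Hilbert spaces; $\mathscr D(\cdot)$ is the set of density operators. For a probability distribution $P$ and a nonnegative measure $Q$ on a finite set, let $D_\alpha(P\|Q)$ be the classical Rényi divergence: for $\alpha\in(0,1)\cup(1,\infty)$, $$D_\alpha(P\|Q)=\frac1{\alpha-1}\log\sum_x P(x)^\alpha Q(x)^{1-\alpha}$$ if ($\alpha<1$ and $P\not\perp Q$) or $P\ll Q$, and $+\infty$ otherwise; for $\alpha=1$, $D_1(P\|Q)=\sum_x P(x)\log\frac{P(x)}{Q(x)}$ if $P\ll Q$ and $+\infty$ otherwise. For a state $\rho$ and a positive semidefinite $\sigma$, the measured Rényi divergence is $$D_{M,\alpha}(\rho\|\sigma)=\sup_{(M_x)_x}D_\alpha\big((\mathrm{tr}[M_x\rho])_x\,\big\|\,(\mathrm{tr}[M_x\sigma])_x\big),$$ the supremum being over all positive operator valued measures with finitely many outcomes. For a completely positive trace-preserving (CPTP) map $\mathcal N_{AE\to B}$ and a completely positive (CP) map $\mathcal M_{AE\to B}$, with input system $A$ and jammer system $E$, the measured Rényi minimax channel divergence is $$D^{\mathrm{mx}}_{M,\alpha}(\mathcal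 N\|\mathcal M)=\sup_{R,\ \rho_{AR}\in\mathscr D(AR)}\ \inf_{\sigma_E,\omega_E\in\mathscr D(E)}D_{M,\alpha}\big(\mathcal N_{AE\to B}(\rho_{AR}\otimes\sigma_E)\,\big\|\,\mathcal M_{AE\to B}(\rho_{AR}\otimes\omega_E)\big)\in(-\infty,+\infty],$$ where the reference system $R$ has arbitrary finite dimension and is acted on by the identity. **Lemma (Super-additivity).** Let $\alpha\in(0,\infty)$. For all $\mathcal N^{(i)}\in\mathrm{CPTP}(A_iE_i:B_i)$ and $\mathcal M^{(i)}\in\mathrm{CP}(A_iE_i:B_i)$, $i\in\{1,2\}$, $$D^{\mathrm{mx}}_{M,\alpha}\big(\mathcal N^{(1)}\otimes\mathcal N^{(2)}\,\big\|\,\mathcal M^{(1)}\otimes\mathcal M^{(2)}\big)\ \ge\ D^{\mathrm{mx}}_{M,\alpha}\big(\mathcal N^{(1)}\big\|\mathcal M^{(1)}\big)+D^{\mathrm{mx}}_{M,\alpha}\big(\mathcal N^{(2)}\big\|\mathcal M^{(2)}\big),$$ where the tensor product has input system $A_1A_2$, jammer system $E_1E_2$ and output system $B_1B_2$. Consequently,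 for all $\mathcal N\in\mathrm{CPTP}(AE:B)$ and $\mathcal M\in\mathrm{CP}(AE:B)$, the regularization exists as a limit in $(-\infty,+\infty]$ and $$\lim_{n\to\infty}\frac1n D^{\mathrm{mx}}_{M,\alpha}(\mathcal N^{\otimes n}\|\mathcal M^{\otimes n})=\sup_{n\ge1}\frac1n D^{\mathrm{mx}}_{M,\alpha}(\mathcal N^{\otimes n}\|\mathcal M^{\otimes n}),$$ where $\mathcal N^{\otimes n}$ and $\mathcal M^{\otimes n}$ have input system $A^n$, jammer system $E^n$ and output system $B^n$. -/

import Mathlib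

/-!
Finite-dimensional quantum systems are represented by finite nonempty index types: the system `A`
has the Hilbert space with orthonormal basis indexed by `A`, its operators are the matrices
`Matrix A A ℂ`, and composite systems are indexed by products.
-/

set_option linter.unusedSectionVars false

namespace JammerChannel

open scoped Kronecker ComplexOrder
open Matrix

section Maps

variable {m n m₁ n₁ m₂ n₂ : Type*}
  [Fintype m] [DecidableEq m] [Fintype n] [DecidableEq n]
  [Fintype m₁] [DecidableEq m₁] [Fintype n₁] [DecidableEq n₁]
  [Fintype m₂] [DecidableEq m₂] [Fintype n₂] [DecidableEq n₂]

/-- The set of density operators: positive semidefinite matrices of trace one. -/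
def densityOps (n : Type*) [Fintype n] : Set (Matrix n n ℂ) :=
  {ρ | ρ.PosSemidef ∧ ρ.trace = 1}

/-- The tensor product `Φ ⊗ Ψ` of two linear maps between matrix spaces. -/
noncomputable def tensorMap (Φ : Matrix m₁ m₁ ℂ →ₗ[ℂ] Matrix n₁ n₁ ℂ)
    (Ψ : Matrix m₂ m₂ ℂ →ₗ[ℂ] Matrix n₂ n₂ ℂ) :
    Matrix (m₁ × m₂) (m₁ × m₂) ℂ →ₗ[ℂ] Matrix (n₁ × n₂) (n₁ × n₂) ℂ :=
  (kroneckerLinearEquiv n₁ n₁ n₂ n₂ ℂ).toLinearMap ∘ₗ TensorProduct.map Φ Ψ ∘ₗ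
    (kroneckerLinearEquiv m₁ m₁ m₂ m₂ ℂ).symm.toLinearMap

theorem tensorMap_kronecker (Φ : Matrix m₁ m₁ ℂ →ₗ[ℂ] Matrix n₁ n₁ ℂ)
    (Ψ : Matrix m₂ m₂ ℂ →ₗ[ℂ] Matrix n₂ n₂ ℂ) (X : Matrix m₁ m₁ ℂ) (Y : Matrix m₂ m₂ ℂ) :
    tensorMap Φ Ψ (X ⊗ₖ Y) = Φ X ⊗ₖ Ψ Y := by
  simp [tensorMap]

open scoped Matrix.Norms.L2Operator MatrixOrder in
/-- `Φ` is completely positive. -/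
def IsCP (Φ : Matrix m m ℂ →ₗ[ℂ] Matrix n n ℂ) : Prop :=
  ∃ φ : CompletelyPositiveMap (Matrix m m ℂ) (Matrix n n ℂ), φ.toLinearMap = Φ

theorem tensorMap_id_apply {k : ℕ} (Φ : Matrix m m ℂ →ₗ[ℂ] Matrix n n ℂ)
    (X : Matrix (m × Fin k) (m × Fin k) ℂ) (x y : n × Fin k) :
    tensorMap Φ LinearMap.id X x y =
      Φ (Matrix.of fun a a' => X (a, x.2) (a', y.2)) x.1 y.1 := by
  obtain ⟨t, rfl⟩ := (kroneckerLinearEquiv m m (Fin k) (Fin k) ℂ).surjective X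
  induction t using TensorProduct.induction_on with
  | zero =>
    have : (Matrix.of fun _ _ => 0 : Matrix m m ℂ) = 0 := rfl
    simp [this]
  | tmul P Q =>
    have : (Matrix.of fun a a' => (P ⊗ₖ Q) (a, x.2) (a', y.2)) = Q x.2 y.2 • P := by
      ext a a'
      simp [mul_comm]
    rw [kroneckerLinearEquiv_tmul, this, tensorMap_kronecker, map_smul]
    simp [mul_comm]
  | add s t hs ht =>
    have : (Matrix.of fun a a' => (kroneckerLinearEquiv m m (Fin k) (Fin k) ℂ (s + t))
        (a, x.2) (a', y.2)) =
      (Matrix.of fun a a' => (kroneckerLinearEquiv m m (Fin k) (Fin k) ℂ s) (a, x.2) (a', y.2)) +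
      (Matrix.of fun a a' => (kroneckerLinearEquiv m m (Fin k) (Fin k) ℂ t)
        (a, x.2) (a', y.2)) := by
      ext a a'
      simp
    rw [this, map_add, map_add, map_add, Matrix.add_apply, Matrix.add_apply, hs, ht]

theorem nonneg_iff_exists_star_mul_self {𝒜 : Type*} [CStarAlgebra 𝒜] [PartialOrder 𝒜]
    [StarOrderedRing 𝒜] {a : 𝒜} : 0 ≤ a ↔ ∃ b, a = star b * b :=
  CStarAlgebra.nonneg_iff_eq_star_mul_self

open scoped Matrix.Norms.L2Operator MatrixOrder CStarAlgebra in
theorem cstarMatrix_nonneg_iff {k : ℕ} (M : CStarMatrix (Fin k) (Fin k) (Matrix m m ℂ)) :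
    0 ≤ M ↔ (Matrix.of fun x y : m × Fin k => M x.2 y.2 x.1 y.1).PosSemidef := by
  have comp : ∀ N : CStarMatrix (Fin k) (Fin k) (Matrix m m ℂ), ∀ i j a b,
      (star N * N) i j a b = ∑ x : m × Fin k, star (N x.2 i x.1 a) * N x.2 j x.1 b := by
    intro N i j a b
    rw [CStarMatrix.mul_apply, Matrix.sum_apply, Fintype.sum_prod_type_right]
    refine Finset.sum_congr rfl fun l _ => ?_
    rw [Matrix.mul_apply]
    rfl
  constructor
  · intro h
    obtain ⟨N, rfl⟩ := nonneg_iff_exists_star_mul_self.mp h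
    have : (Matrix.of fun x y : m × Fin k => (star N * N) x.2 y.2 x.1 y.1) =
        (Matrix.of fun x y : m × Fin k => N x.2 y.2 x.1 y.1)ᴴ *
          (Matrix.of fun x y : m × Fin k => N x.2 y.2 x.1 y.1) := by
      ext x y
      rw [Matrix.of_apply, comp, Matrix.mul_apply]
      rfl
    rw [this]
    exact Matrix.posSemidef_conjTranspose_mul_self _
  · intro h
    obtain ⟨B, hB⟩ := nonneg_iff_exists_star_mul_self.mp h.nonneg
    have : M = star (CStarMatrix.ofMatrix (Matrix.of fun i j => Matrix.of fun a b => B (a, i) (b, j)) :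
          CStarMatrix (Fin k) (Fin k) (Matrix m m ℂ)) *
        CStarMatrix.ofMatrix (Matrix.of fun i j => Matrix.of fun a b => B (a, i) (b, j)) := by
      ext i j a b
      rw [comp]
      have := congrFun (congrFun hB (a, i)) (b, j)
      rw [Matrix.mul_apply] at this
      exact this
    rw [this]
    exact star_mul_self_nonneg _

open scoped Matrix.Norms.L2Operator MatrixOrder CStarAlgebra in
/-- `Φ` is completely positive iff `Φ ⊗ id_k` preserves positive semidefiniteness for all `k`. -/
theorem isCP_iff (Φ : Matrix m m ℂ →ₗ[ℂ] Matrix n n ℂ) :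
    IsCP Φ ↔ ∀ (k : ℕ) (X : Matrix (m × Fin k) (m × Fin k) ℂ), X.PosSemidef →
      (tensorMap Φ (LinearMap.id : Matrix (Fin k) (Fin k) ℂ →ₗ[ℂ] _) X).PosSemidef := by
  constructor
  · rintro ⟨φ, rfl⟩ k X hX
    have h := φ.map_cstarMatrix_nonneg' k
      (CStarMatrix.ofMatrix (Matrix.of fun i j => Matrix.of fun a b => X (a, i) (b, j)))
      ((cstarMatrix_nonneg_iff _).2 hX)
    have h' := (cstarMatrix_nonneg_iff _).1 h
    convert h' using 1
    ext x y
    exact tensorMap_id_apply φ.toLinearMap X x y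
  · intro h
    refine ⟨⟨Φ, fun k M hM => (cstarMatrix_nonneg_iff _).2 ?_⟩, rfl⟩
    have h' := h k _ ((cstarMatrix_nonneg_iff _).1 hM)
    convert h' using 1
    ext x y
    exact (tensorMap_id_apply Φ
      (Matrix.of fun x y : m × Fin k => M x.2 y.2 x.1 y.1) x y).symm

/-- `Φ` is completely positive and trace preserving, that is, a quantum channel. -/
def IsCPTP (Φ : Matrix m m ℂ →ₗ[ℂ] Matrix n n ℂ) : Prop :=
  IsCP Φ ∧ ∀ X, (Φ X).trace = X.trace

end Maps

section Power

variable {m n : Type*} [Fintype m] [DecidableEq m]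

/-- The `k`-fold tensor power `Φ^{⊗k}` of a linear map between matrix spaces, on the systems
indexed by `Fin k → m` and `Fin k → n`: the linear extension of
`E_{a₁a₁'} ⊗ ⋯ ⊗ E_{aₖaₖ'} ↦ Φ(E_{a₁a₁'}) ⊗ ⋯ ⊗ Φ(E_{aₖaₖ'})` (matrix units). -/
noncomputable def tensorPow (Φ : Matrix m m ℂ →ₗ[ℂ] Matrix n n ℂ) (k : ℕ) :
    Matrix (Fin k → m) (Fin k → m) ℂ →ₗ[ℂ] Matrix (Fin k → n) (Fin k → n) ℂ where
  toFun X := Matrix.of fun b b' =>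
    ∑ a, ∑ a', X a a' * ∏ i, Φ (Matrix.single (a i) (a' i) 1) (b i) (b' i)
  map_add' X Y := by
    ext b b'
    simp [add_mul, Finset.sum_add_distrib]
  map_smul' c X := by
    ext b b'
    simp [mul_assoc, Finset.mul_sum]

theorem tensorPow_prod (Φ : Matrix m m ℂ →ₗ[ℂ] Matrix n n ℂ) (k : ℕ)
    (X : Fin k → Matrix m m ℂ) :
    tensorPow Φ k (Matrix.of fun a a' => ∏ i, X i (a i) (a' i)) =
      Matrix.of fun b b' => ∏ i, Φ (X i) (b i) (b' i) := by
  have key : ∀ (Z : Matrix m m ℂ) (b b' : n),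
      Φ Z b b' = ∑ p, ∑ q, Z p q * Φ (Matrix.single p q 1) b b' := by
    intro Z b b'
    conv_lhs => rw [Matrix.matrix_eq_sum_single Z]
    simp only [map_sum, Matrix.sum_apply]
    refine Finset.sum_congr rfl fun p _ => Finset.sum_congr rfl fun q _ => ?_
    have : Matrix.single p q (Z p q) = Z p q • Matrix.single p q (1 : ℂ) := by
      simp [Matrix.smul_single]
    rw [this, map_smul, Matrix.smul_apply, smul_eq_mul]
  ext b b'
  simp only [tensorPow, LinearMap.coe_mk, AddHom.coe_mk, Matrix.of_apply]
  simp only [key (X _), Finset.prod_univ_sum, Fintype.piFinset_univ, ← Finset.prod_mul_distrib]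

end Power

section Divergence

/-- The classical Rényi divergence `D_α(P‖Q)` of order `α ∈ (0,∞)` of a probability distribution
`P` with respect to a nonnegative measure `Q` on a finite set (natural logarithm); for `α = 1` it is
the relative entropy. It is `+∞` if `P ⟂ Q`, and for `α ≥ 1` as soon as `P` is not absolutely
continuous with respect to `Q`. -/
noncomputable def renyiDiv (α : ℝ) {X : Type*} [Fintype X] (P Q : X → ℝ) : EReal :=
  open Classical in
  if α = 1 then
    if ∀ x, Q x = 0 → P x = 0 then ((∑ x, P x * Real.log (P x / Q x) : ℝ) : EReal) else ⊤
  else if (α < 1 ∧ ∃ x, P x ≠ 0 ∧ Q x ≠ 0) ∨ ∀ x, Q x = 0 → P x = 0 then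
    (((α - 1)⁻¹ * Real.log (∑ x, P x ^ α * Q x ^ (1 - α)) : ℝ) : EReal)
  else ⊤

/-- `M` is a positive operator valued measure with finite outcome set `Fin k`. -/
def IsPOVM {n : Type*} [Fintype n] [DecidableEq n] {k : ℕ} (M : Fin k → Matrix n n ℂ) : Prop :=
  (∀ x, (M x).PosSemidef) ∧ ∑ x, M x = 1

/-- The measure `x ↦ tr[M_x ρ]` of outcomes when `ρ` is measured with `M`. -/
noncomputable def outcome {n : Type*} [Fintype n] {k : ℕ} (M : Fin k → Matrix n n ℂ)
    (ρ : Matrix n n ℂ) : Fin k → ℝ :=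
  fun x => (M x * ρ).trace.re

/-- The measured Rényi divergence `D_{M,α}(ρ‖σ)`. -/
noncomputable def measuredRenyi (α : ℝ) {n : Type*} [Fintype n] [DecidableEq n]
    (ρ σ : Matrix n n ℂ) : EReal :=
  ⨆ (k : ℕ) (M : Fin k → Matrix n n ℂ) (_ : IsPOVM M), renyiDiv α (outcome M ρ) (outcome M σ)

end Divergence

section Jammer

variable {A E B R A₁ E₁ B₁ A₂ E₂ B₂ : Type*}
  [Fintype A] [DecidableEq A] [Fintype E] [DecidableEq E] [Fintype B] [DecidableEq B]
  [Fintype R] [DecidableEq R]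
  [Fintype A₁] [DecidableEq A₁] [Fintype E₁] [DecidableEq E₁] [Fintype B₁] [DecidableEq B₁]
  [Fintype A₂] [DecidableEq A₂] [Fintype E₂] [DecidableEq E₂] [Fintype B₂] [DecidableEq B₂]

/-- `(N_{AE→B} ⊗ id_R)(ρ_{AR} ⊗ σ_E)`, an operator on `B ⊗ R`. -/
noncomputable def jammedOutput (N : Matrix (A × E) (A × E) ℂ →ₗ[ℂ] Matrix B B ℂ)
    (ρ : Matrix (A × R) (A × R) ℂ) (σ : Matrix E E ℂ) : Matrix (B × R) (B × R) ℂ :=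
  tensorMap N LinearMap.id
    ((ρ ⊗ₖ σ).submatrix (fun x : (A × E) × R => ((x.1.1, x.2), x.1.2))
      (fun x : (A × E) × R => ((x.1.1, x.2), x.1.2)))

theorem jammedOutput_kronecker (N : Matrix (A × E) (A × E) ℂ →ₗ[ℂ] Matrix B B ℂ)
    (ρ : Matrix A A ℂ) (τ : Matrix R R ℂ) (σ : Matrix E E ℂ) :
    jammedOutput N (ρ ⊗ₖ τ) σ = N (ρ ⊗ₖ σ) ⊗ₖ τ := by
  have h : ((ρ ⊗ₖ τ) ⊗ₖ σ).submatrix (fun x : (A × E) × R => ((x.1.1, x.2), x.1.2))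
      (fun x : (A × E) × R => ((x.1.1, x.2), x.1.2)) = (ρ ⊗ₖ σ) ⊗ₖ τ := by
    ext x y
    simp only [Matrix.submatrix_apply, Matrix.kroneckerMap_apply]
    ring
  rw [jammedOutput, h, tensorMap_kronecker, LinearMap.id_apply]

/-- The measured Rényi minimax channel divergence: the supremum over finite-dimensional reference
systems `R` (of any dimension `r`) and states of `AR` of the infimum over pairs of jammer states. -/
noncomputable def minimaxDiv (α : ℝ) (N M : Matrix (A × E) (A × E) ℂ →ₗ[ℂ] Matrix B B ℂ) :
    EReal :=
  ⨆ (r : ℕ) (ρ ∈ densityOps (A × Fin r)), ⨅ (σ ∈ densityOps E) (ω ∈ densityOps E),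
    measuredRenyi α (jammedOutput N ρ σ) (jammedOutput M ρ ω)

/-- The tensor product of two jammer channels, with input `A₁A₂` and jammer system `E₁E₂`. -/
noncomputable def jammerTensor (N₁ : Matrix (A₁ × E₁) (A₁ × E₁) ℂ →ₗ[ℂ] Matrix B₁ B₁ ℂ)
    (N₂ : Matrix (A₂ × E₂) (A₂ × E₂) ℂ →ₗ[ℂ] Matrix B₂ B₂ ℂ) :
    Matrix ((A₁ × A₂) × (E₁ × E₂)) ((A₁ × A₂) × (E₁ × E₂)) ℂ →ₗ[ℂ]
      Matrix (B₁ × B₂) (B₁ × B₂) ℂ :=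
  tensorMap N₁ N₂ ∘ₗ (Matrix.reindexLinearEquiv ℂ ℂ (Equiv.prodProdProdComm A₁ A₂ E₁ E₂)
    (Equiv.prodProdProdComm A₁ A₂ E₁ E₂)).toLinearMap

theorem jammerTensor_kronecker (N₁ : Matrix (A₁ × E₁) (A₁ × E₁) ℂ →ₗ[ℂ] Matrix B₁ B₁ ℂ)
    (N₂ : Matrix (A₂ × E₂) (A₂ × E₂) ℂ →ₗ[ℂ] Matrix B₂ B₂ ℂ)
    (X₁ : Matrix A₁ A₁ ℂ) (X₂ : Matrix A₂ A₂ ℂ) (Y₁ : Matrix E₁ E₁ ℂ) (Y₂ : Matrix E₂ E₂ ℂ) :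
    jammerTensor N₁ N₂ ((X₁ ⊗ₖ X₂) ⊗ₖ (Y₁ ⊗ₖ Y₂)) = N₁ (X₁ ⊗ₖ Y₁) ⊗ₖ N₂ (X₂ ⊗ₖ Y₂) := by
  have h : Matrix.reindexLinearEquiv ℂ ℂ (Equiv.prodProdProdComm A₁ A₂ E₁ E₂)
      (Equiv.prodProdProdComm A₁ A₂ E₁ E₂) ((X₁ ⊗ₖ X₂) ⊗ₖ (Y₁ ⊗ₖ Y₂)) =
      (X₁ ⊗ₖ Y₁) ⊗ₖ (X₂ ⊗ₖ Y₂) := by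
    ext x y
    simp [Matrix.coe_reindexLinearEquiv, Equiv.prodProdProdComm]
    ring
  rw [jammerTensor, LinearMap.comp_apply, LinearEquiv.coe_coe, h, tensorMap_kronecker]

/-- The `k`-fold tensor power of a jammer channel, with input `A^k` and jammer system `E^k`. -/
noncomputable def jammerPow (N : Matrix (A × E) (A × E) ℂ →ₗ[ℂ] Matrix B B ℂ) (k : ℕ) :
    Matrix ((Fin k → A) × (Fin k → E)) ((Fin k → A) × (Fin k → E)) ℂ →ₗ[ℂ]
      Matrix (Fin k → B) (Fin k → B) ℂ :=
  tensorPow N k ∘ₗ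
    (Matrix.reindexLinearEquiv ℂ ℂ
      (Equiv.arrowProdEquivProdArrow (Fin k) (fun _ => A) (fun _ => E)).symm
      (Equiv.arrowProdEquivProdArrow (Fin k) (fun _ => A) (fun _ => E)).symm).toLinearMap

theorem jammerPow_prod (N : Matrix (A × E) (A × E) ℂ →ₗ[ℂ] Matrix B B ℂ) (k : ℕ)
    (X : Fin k → Matrix A A ℂ) (Y : Fin k → Matrix E E ℂ) :
    jammerPow N k ((Matrix.of fun a a' => ∏ i, X i (a i) (a' i)) ⊗ₖ
        (Matrix.of fun e e' => ∏ i, Y i (e i) (e' i))) =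
      Matrix.of fun b b' => ∏ i, N (X i ⊗ₖ Y i) (b i) (b' i) := by
  rw [← tensorPow_prod, jammerPow, LinearMap.comp_apply]
  congr 1
  ext x y
  simp [Matrix.coe_reindexLinearEquiv, Finset.prod_mul_distrib, Equiv.arrowProdEquivProdArrow]

end Jammer

end JammerChannel

/-!
The divergence of a product is bounded from below by exhibiting a product measurement. This needs,
for each factor, one measurement that works against all jammer states, whereas the definition lets
the measurement depend on them, and so a minimax theorem.

*One measurement for all jammer states.* Up to a monotone transformation, `D_α(P‖Q)` is the sum over
the outcomes `x` of `renyiTerm α (P x) (Q x)`, and `renyiTerm α` is a supremum of linear functionals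
of `(p, q)` (`exists_isMinorant_lt`, a form of Young's inequality). A measurement together with one
such functional per outcome is thus a continuous affine function of the pair of jammer states, and
the divergence is a supremum of these functions. They form a convex set, because measurements can be
mixed with the choice recorded (`IsPOVM.append`), and the set of pairs of jammer states is compact
and convex. Sion's minimax theorem exchanges supremum and infimum (`exists_povm_of_lt_iInf`).

*Product measurements.* Let the outcomes `(x, y)` come from a product measurement on a product
channel with a possibly entangled jammer state. The first outcome has the distribution belonging to
the reduced jammer state, and given `x` the second outcome has the distribution belonging to a
conditional state of the second jammer (`Factors.exists_conditional`). Since the lower bound for the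
second factor holds for all jammer states, the chain rule for conditional distributions
(`add_le_renyiDiv_of_conditional`) gives `minimaxDiv_add_le`.

*Regularization.* The powers of a channel are channels (`IsCPTP.jammerPow`) and factor as products
(`factors_jammerPow`), so the divergences of the powers are superadditive. None of them is `-∞`
(`bot_lt_minimaxDiv`), and Fekete's lemma for `(-∞, ∞]` applies
(`tendsto_inv_mul_of_superadditive`).
-/

namespace JammerChannel

open scoped Kronecker ComplexOrder
open Matrix

/-! ### The classical Rényi divergence as a supremum of linear functionals -/

/-- The summand whose total determines the Rényi divergence of order `α`: it is `p log (p / q)` for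
`α = 1` and `sign (α - 1) p ^ α q ^ (1 - α)` otherwise. With this sign the divergence is increasing
in the total, and the summand is jointly convex. -/
noncomputable def renyiTerm (α p q : ℝ) : ℝ :=
  if α = 1 then p * Real.log (p / q)
  else if α < 1 then -(p ^ α * q ^ (1 - α)) else p ^ α * q ^ (1 - α)

/-- The total of `renyiTerm α` that corresponds to the value `c` of the Rényi divergence. -/
noncomputable def renyiLevel (α c : ℝ) : ℝ :=
  if α = 1 then c
  else if α < 1 then -Real.exp ((α - 1) * c) else Real.exp ((α - 1) * c)

/-- The linear functional `(p, q) ↦ a p + b q` lies below `renyiTerm α` wherever the latter is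
meaningful: for `α ≥ 1` the points `p > 0 = q`, at which the divergence is infinite, are left
out. -/
def IsMinorant (α a b : ℝ) : Prop :=
  ∀ p q : ℝ, 0 ≤ p → 0 ≤ q → (1 ≤ α → q = 0 → p = 0) → a * p + b * q ≤ renyiTerm α p q

theorem renyiLevel_lt {α c d : ℝ} (h : c < d) : renyiLevel α c < renyiLevel α d := by
  unfold renyiLevel
  split_ifs with h1 h2
  · exact h
  · have : (α - 1) * d < (α - 1) * c := mul_lt_mul_of_neg_left h (by linarith)
    simpa using this
  · have h3 : 1 < α := lt_of_le_of_ne (not_lt.1 h2) (Ne.symm h1)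
    have : (α - 1) * c < (α - 1) * d := mul_lt_mul_of_pos_left h (by linarith)
    simpa using this

/-- For a probability distribution `P`, the divergence is at least `c` iff it is infinite for want
of absolute continuity, or the total of the summands reaches the level of `c`. -/
theorem le_renyiDiv_iff {α : ℝ} (hα : 0 < α) {X : Type*} [Fintype X] {P Q : X → ℝ}
    (hP : ∀ x, 0 ≤ P x) (hQ : ∀ x, 0 ≤ Q x) (hs : ∑ x, P x = 1) (c : ℝ) :
    (c : EReal) ≤ renyiDiv α P Q ↔
      (1 ≤ α ∧ ¬ ∀ x, Q x = 0 → P x = 0) ∨ renyiLevel α c ≤ ∑ x, renyiTerm α (P x) (Q x) := by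
  have hne : ∃ x, P x ≠ 0 := by
    by_contra! h
    simp [h] at hs
  have hnn : ∀ x, 0 ≤ P x ^ α * Q x ^ (1 - α) := fun x =>
    mul_nonneg (Real.rpow_nonneg (hP x) _) (Real.rpow_nonneg (hQ x) _)
  unfold renyiDiv renyiLevel renyiTerm
  rcases lt_trichotomy α 1 with h | rfl | h
  · have h1 : ¬ (1 ≤ α) := not_le.2 h
    simp only [h.ne, if_false, h, if_true, h1, false_and, false_or, true_and,
      Finset.sum_neg_distrib, neg_le_neg_iff]
    by_cases hx : ∃ x, P x ≠ 0 ∧ Q x ≠ 0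
    · rw [if_pos (Or.inl hx), EReal.coe_le_coe_iff]
      have hpos : 0 < ∑ x, P x ^ α * Q x ^ (1 - α) := by
        obtain ⟨x, hx1, hx2⟩ := hx
        refine Finset.sum_pos' (fun y _ => hnn y) ⟨x, Finset.mem_univ _, ?_⟩
        exact mul_pos (Real.rpow_pos_of_pos (lt_of_le_of_ne (hP x) hx1.symm) _)
          (Real.rpow_pos_of_pos (lt_of_le_of_ne (hQ x) hx2.symm) _)
      rw [← Real.log_le_iff_le_exp hpos, inv_mul_eq_div, le_div_iff_of_neg (by linarith), mul_comm]
    · have hac : ¬ ∀ x, Q x = 0 → P x = 0 := by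
        intro hac
        obtain ⟨x, hx'⟩ := hne
        exact hx ⟨x, hx', fun h0 => hx' (hac x h0)⟩
      rw [if_neg (not_or.2 ⟨hx, hac⟩)]
      push Not at hx
      have : ∑ x, P x ^ α * Q x ^ (1 - α) = 0 := by
        refine Finset.sum_eq_zero fun x _ => ?_
        by_cases h0 : P x = 0
        · rw [h0, Real.zero_rpow hα.ne', zero_mul]
        · rw [hx x h0, Real.zero_rpow (by linarith), mul_zero]
      simp [this, Real.exp_nonneg]
  · simp only [if_true, le_refl, true_and]
    split_ifs with hac
    · rw [EReal.coe_le_coe_iff, or_iff_right (not_not_intro hac)]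
    · simp [hac]
  · have h1 : ¬ (α < 1) := not_lt.2 h.le
    simp only [h.ne', if_false, h1, false_and, false_or, h.le, true_and]
    by_cases hac : ∀ x, Q x = 0 → P x = 0
    · rw [if_pos hac, EReal.coe_le_coe_iff]
      have hpos : 0 < ∑ x, P x ^ α * Q x ^ (1 - α) := by
        obtain ⟨x, hx⟩ := hne
        refine Finset.sum_pos' (fun y _ => hnn y) ⟨x, Finset.mem_univ _, ?_⟩
        exact mul_pos (Real.rpow_pos_of_pos (lt_of_le_of_ne (hP x) hx.symm) _)
          (Real.rpow_pos_of_pos (lt_of_le_of_ne (hQ x) fun h0 => hx (hac x h0.symm)) _)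
      rw [← Real.le_log_iff_exp_le hpos, inv_mul_eq_div, le_div_iff₀ (by linarith), mul_comm,
        or_iff_right (not_not_intro hac)]
    · rw [if_neg hac]
      simp [hac]

/-- Young's inequality with slope `t`, an equality for `p = t q`. -/
theorem rpow_mul_rpow_le {α t p q : ℝ} (h0 : 0 < α) (h : α < 1) (ht : 0 < t) (hp : 0 ≤ p)
    (hq : 0 ≤ q) : p ^ α * q ^ (1 - α) ≤ α * t ^ (α - 1) * p + (1 - α) * t ^ α * q := by
  have := Real.geom_mean_le_arith_mean2_weighted h0.le (sub_nonneg.2 h.le)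
    (mul_nonneg (Real.rpow_nonneg ht.le (α - 1)) hp) (mul_nonneg (Real.rpow_nonneg ht.le α) hq)
    (by ring)
  rw [Real.mul_rpow (by positivity) hp, Real.mul_rpow (by positivity) hq, ← Real.rpow_mul ht.le,
    ← Real.rpow_mul ht.le] at this
  have h1 : t ^ ((α - 1) * α) * t ^ (α * (1 - α)) = 1 := by
    rw [← Real.rpow_add ht]
    ring_nf
    simp
  calc p ^ α * q ^ (1 - α) = (t ^ ((α - 1) * α) * t ^ (α * (1 - α))) * (p ^ α * q ^ (1 - α)) := by
        rw [h1, one_mul]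
    _ ≤ _ := by linarith

/-- Young's inequality in the range `α > 1`, again an equality for `p = t q`. -/
theorem le_rpow_mul_rpow {α t p q : ℝ} (h : 1 < α) (ht : 0 < t) (hp : 0 ≤ p)
    (hq : 0 < q) : α * t ^ (α - 1) * p - (α - 1) * t ^ α * q ≤ p ^ α * q ^ (1 - α) := by
  have h0 : 0 < α := by linarith
  have := Real.geom_mean_le_arith_mean2_weighted (w₁ := α⁻¹) (w₂ := (α - 1) / α) (by positivity)
    (div_nonneg (by linarith) h0.le)
    (mul_nonneg (Real.rpow_nonneg hp α) (Real.rpow_nonneg hq.le (1 - α)))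
    (mul_nonneg (Real.rpow_nonneg ht.le α) hq.le) (by field_simp; ring)
  rw [Real.mul_rpow (by positivity) (by positivity), Real.mul_rpow (by positivity) hq.le,
    ← Real.rpow_mul ht.le, ← Real.rpow_mul hp, ← Real.rpow_mul hq.le, mul_inv_cancel₀ h0.ne',
    mul_div_cancel₀ _ h0.ne', Real.rpow_one] at this
  have h1 : q ^ ((1 - α) * α⁻¹) * q ^ ((α - 1) / α) = 1 := by
    rw [← Real.rpow_add hq]
    have : (1 - α) * α⁻¹ + (α - 1) / α = 0 := by field_simp; ring
    rw [this, Real.rpow_zero]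
  have h2 : p * t ^ (α - 1) ≤ α⁻¹ * (p ^ α * q ^ (1 - α)) + (α - 1) / α * (t ^ α * q) := by
    calc p * t ^ (α - 1) = p * t ^ (α - 1) * (q ^ ((1 - α) * α⁻¹) * q ^ ((α - 1) / α)) := by
          rw [h1, mul_one]
      _ ≤ _ := by linarith
  have h3 := mul_le_mul_of_nonneg_left h2 h0.le
  have h4 : α * (α⁻¹ * (p ^ α * q ^ (1 - α)) + (α - 1) / α * (t ^ α * q)) =
      p ^ α * q ^ (1 - α) + (α - 1) * (t ^ α * q) := by field_simp
  linarith

theorem isMinorant_of_lt_one {α t : ℝ} (h0 : 0 < α) (h : α < 1) (ht : 0 < t) :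
    IsMinorant α (-(α * t ^ (α - 1))) (-((1 - α) * t ^ α)) := by
  intro p q hp hq _
  rw [renyiTerm, if_neg h.ne, if_pos h]
  linarith [rpow_mul_rpow_le h0 h ht hp hq]

theorem isMinorant_of_one_lt {α t : ℝ} (h : 1 < α) (ht : 0 < t) :
    IsMinorant α (α * t ^ (α - 1)) (-((α - 1) * t ^ α)) := by
  intro p q hp hq hac
  rw [renyiTerm, if_neg h.ne', if_neg (not_lt.2 h.le)]
  rcases hq.eq_or_lt with rfl | hq
  · rw [hac h.le rfl, Real.zero_rpow (by linarith)]
    simp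
  · linarith [le_rpow_mul_rpow h ht hp hq]

theorem isMinorant_one {t : ℝ} (ht : 0 < t) : IsMinorant 1 (1 + Real.log t) (-t) := by
  intro p q hp hq hac
  rw [renyiTerm, if_pos rfl]
  rcases hq.eq_or_lt with rfl | hq
  · rw [hac le_rfl rfl]
    simp
  rcases hp.eq_or_lt with rfl | hp
  · have := mul_pos ht hq
    simp
    linarith
  · have h1 := Real.log_le_sub_one_of_pos (x := t * q / p) (by positivity)
    rw [Real.log_div (by positivity) hp.ne', Real.log_mul ht.ne' hq.ne'] at h1
    rw [Real.log_div hp.ne' hq.ne']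
    have h2 := mul_le_mul_of_nonneg_left h1 hp.le
    have h3 : p * (t * q / p - 1) = t * q - p := by field_simp
    linarith

open Filter Topology in
/-- The summand is the supremum of its linear minorants. -/
theorem exists_isMinorant_lt {α p q ε : ℝ} (hα : 0 < α) (hp : 0 ≤ p) (hq : 0 ≤ q)
    (hac : 1 ≤ α → q = 0 → p = 0) (hε : 0 < ε) :
    ∃ a b, IsMinorant α a b ∧ renyiTerm α p q - ε < a * p + b * q := by
  rcases lt_trichotomy α 1 with h | rfl | h
  · -- The optimal slope is `t = p / q`; approach it by `(p + δ) / (q + δ)`, which is never `0 / 0`.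
    have hlim : Tendsto (fun δ : ℝ => (p + δ) ^ α * (q + δ) ^ (1 - α)) (𝓝[>] 0)
        (𝓝 ((p + 0) ^ α * (q + 0) ^ (1 - α))) := by
      refine Tendsto.mono_left ?_ nhdsWithin_le_nhds
      have hc : Continuous fun δ : ℝ => (p + δ) ^ α * (q + δ) ^ (1 - α) := by
        refine Continuous.mul ?_ ?_
        · exact (continuous_const.add continuous_id).rpow_const fun _ => Or.inr hα.le
        · exact (continuous_const.add continuous_id).rpow_const fun _ => Or.inr (by linarith)
      exact hc.tendsto 0
    rw [add_zero, add_zero] at hlim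
    have hev := hlim.eventually (gt_mem_nhds (lt_add_of_pos_right (p ^ α * q ^ (1 - α)) hε))
    obtain ⟨δ, hδ, hδ0⟩ := (hev.and self_mem_nhdsWithin).exists
    have hδ0 : 0 < δ := hδ0
    have hp' : 0 < p + δ := by linarith
    have hq' : 0 < q + δ := by linarith
    have ht : 0 < (p + δ) / (q + δ) := div_pos hp' hq'
    refine ⟨_, _, isMinorant_of_lt_one hα h ht, ?_⟩
    rw [renyiTerm, if_neg h.ne, if_pos h]
    have e1 : ((p + δ) / (q + δ)) ^ (α - 1) * (p + δ) = (p + δ) ^ α * (q + δ) ^ (1 - α) := by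
      rw [Real.div_rpow hp'.le hq'.le, Real.rpow_sub hp', Real.rpow_sub hq', Real.rpow_sub hq',
        Real.rpow_one, Real.rpow_one]
      field_simp
    have e2 : ((p + δ) / (q + δ)) ^ α * (q + δ) = (p + δ) ^ α * (q + δ) ^ (1 - α) := by
      rw [Real.div_rpow hp'.le hq'.le, Real.rpow_sub hq', Real.rpow_one]
      field_simp
    have f1 : 0 ≤ ((p + δ) / (q + δ)) ^ (α - 1) := by positivity
    have f2 : 0 ≤ ((p + δ) / (q + δ)) ^ α := by positivity
    have g1 : ((p + δ) / (q + δ)) ^ (α - 1) * p ≤ (p + δ) ^ α * (q + δ) ^ (1 - α) := by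
      rw [← e1]
      exact mul_le_mul_of_nonneg_left (by linarith) f1
    have g2 : ((p + δ) / (q + δ)) ^ α * q ≤ (p + δ) ^ α * (q + δ) ^ (1 - α) := by
      rw [← e2]
      exact mul_le_mul_of_nonneg_left (by linarith) f2
    have g1' := mul_le_mul_of_nonneg_left g1 hα.le
    have g2' := mul_le_mul_of_nonneg_left g2 (sub_nonneg.2 h.le)
    linarith
  · rw [renyiTerm, if_pos rfl]
    rcases hp.eq_or_lt with rfl | hp
    · -- The optimal slope would be `0`; take one with `t q < ε`.
      refine ⟨_, _, isMinorant_one (t := ε / (q + 1)) (by positivity), ?_⟩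
      have : ε / (q + 1) * q < ε := by
        rw [div_mul_eq_mul_div, div_lt_iff₀ (by positivity)]
        linarith
      simp
      linarith
    · have hq' : 0 < q := lt_of_le_of_ne hq fun h0 => hp.ne' (hac le_rfl h0.symm)
      refine ⟨_, _, isMinorant_one (t := p / q) (by positivity), ?_⟩
      have : p / q * q = p := by field_simp
      linarith
  · rw [renyiTerm, if_neg h.ne', if_neg (not_lt.2 h.le)]
    rcases hp.eq_or_lt with rfl | hp
    · -- The optimal slope would be `0`; take one with `(α - 1) t ^ α q < ε`.
      have h1 : 0 < α - 1 := by linarith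
      have hδ : 0 < ε / ((α - 1) * (q + 1)) := by positivity
      refine ⟨_, _, isMinorant_of_one_lt h (Real.rpow_pos_of_pos hδ α⁻¹), ?_⟩
      rw [← Real.rpow_mul hδ.le α⁻¹ α, inv_mul_cancel₀ hα.ne', Real.rpow_one,
        Real.zero_rpow hα.ne']
      have : (α - 1) * (ε / ((α - 1) * (q + 1))) * q < ε := by
        have : (α - 1) * (ε / ((α - 1) * (q + 1))) = ε / (q + 1) := by field_simp
        rw [this, div_mul_eq_mul_div, div_lt_iff₀ (by positivity)]
        linarith
      linarith
    · have hq' : 0 < q := lt_of_le_of_ne hq fun h0 => hp.ne' (hac h.le h0.symm)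
      refine ⟨_, _, isMinorant_of_one_lt (t := p / q) h (by positivity), ?_⟩
      have e1 : (p / q) ^ (α - 1) * p = p ^ α * q ^ (1 - α) := by
        rw [Real.div_rpow hp.le hq, Real.rpow_sub hp, Real.rpow_sub hq', Real.rpow_sub hq',
          Real.rpow_one, Real.rpow_one]
        field_simp
      have e2 : (p / q) ^ α * q = p ^ α * q ^ (1 - α) := by
        rw [Real.div_rpow hp.le hq, Real.rpow_sub hq', Real.rpow_one]
        field_simp
      have : α * (p / q) ^ (α - 1) * p + -((α - 1) * (p / q) ^ α) * q =
        α * ((p / q) ^ (α - 1) * p) - (α - 1) * ((p / q) ^ α * q) := by ring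
      rw [this, e1, e2]
      linarith

/-- At a point where `q = 0 < p`, the minorants are unbounded if `α ≥ 1`. -/
theorem exists_isMinorant_gt {α p : ℝ} (hα : 1 ≤ α) (hp : 0 < p) (K : ℝ) :
    ∃ a b, IsMinorant α a b ∧ K < a * p := by
  rcases hα.eq_or_lt with rfl | h
  · refine ⟨_, _, isMinorant_one (Real.exp_pos (K / p)), ?_⟩
    rw [Real.log_exp]
    have : (1 + K / p) * p = p + K := by field_simp
    linarith
  · have h1 : 0 < α - 1 := by linarith
    have ht : 0 < (|K| / p + 1) ^ (α - 1)⁻¹ := by positivity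
    refine ⟨_, _, isMinorant_of_one_lt h ht, ?_⟩
    rw [← Real.rpow_mul (by positivity), inv_mul_cancel₀ h1.ne', Real.rpow_one]
    have h2 : α * (|K| / p + 1) * p = α * (|K| + p) := by field_simp
    rw [h2]
    nlinarith [le_abs_self K, abs_nonneg K]

/-- A strict lower bound on the divergence is witnessed by minorants, one for each outcome. -/
theorem exists_isMinorant_of_lt_renyiDiv {α : ℝ} (hα : 0 < α) {X : Type*} [Fintype X]
    {P Q : X → ℝ} (hP : ∀ x, 0 ≤ P x) (hQ : ∀ x, 0 ≤ Q x) (hs : ∑ x, P x = 1) {c : ℝ}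
    (hc : (c : EReal) < renyiDiv α P Q) :
    ∃ a b : X → ℝ, (∀ x, IsMinorant α (a x) (b x)) ∧
      renyiLevel α c < ∑ x, (a x * P x + b x * Q x) := by
  classical
  obtain ⟨d, hcd, hd⟩ := EReal.exists_between_coe_real hc
  rw [EReal.coe_lt_coe_iff] at hcd
  by_cases hac : 1 ≤ α → ∀ x, Q x = 0 → P x = 0
  · have hle : renyiLevel α d ≤ ∑ x, renyiTerm α (P x) (Q x) := by
      rcases (le_renyiDiv_iff hα hP hQ hs d).1 hd.le with ⟨h1, h2⟩ | h
      · exact absurd (hac h1) h2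
      · exact h
    have hlt : 0 < ∑ x, renyiTerm α (P x) (Q x) - renyiLevel α c := by
      linarith [renyiLevel_lt (α := α) hcd]
    have hX : 0 < Fintype.card X := by
      rw [Fintype.card_pos_iff]
      by_contra h
      rw [not_nonempty_iff] at h
      simp at hs
    have hX' : (0 : ℝ) < Fintype.card X := by exact_mod_cast hX
    choose a b hab hlow using fun x =>
      exists_isMinorant_lt hα (hP x) (hQ x) (fun h1 => hac h1 x) (div_pos hlt hX')
    refine ⟨a, b, hab, ?_⟩
    have := Finset.sum_lt_sum_of_nonempty (Finset.univ_nonempty_iff.2 (Fintype.card_pos_iff.1 hX))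
      fun x _ => hlow x
    rw [Finset.sum_sub_distrib, Finset.sum_const, Finset.card_univ, nsmul_eq_mul,
      mul_div_cancel₀ _ hX'.ne'] at this
    linarith
  · -- One outcome with `Q x₀ = 0 < P x₀` outweighs whatever the others contribute.
    push Not at hac
    obtain ⟨h1, x₀, hQ0, hP0⟩ := hac
    obtain ⟨a₀, b₀, h₀, -⟩ :=
      exists_isMinorant_lt (ε := 1) hα le_rfl le_rfl (fun _ _ => rfl) one_pos
    obtain ⟨a₁, b₁, h₁, hK⟩ := exists_isMinorant_gt h1 (lt_of_le_of_ne (hP x₀) hP0.symm)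
      (renyiLevel α c - ∑ x ∈ Finset.univ.erase x₀, (a₀ * P x + b₀ * Q x))
    refine ⟨fun x => if x = x₀ then a₁ else a₀, fun x => if x = x₀ then b₁ else b₀, ?_, ?_⟩
    · intro x
      dsimp only
      split_ifs
      · exact h₁
      · exact h₀
    · rw [← Finset.add_sum_erase _ _ (Finset.mem_univ x₀)]
      have : ∑ x ∈ Finset.univ.erase x₀, ((if x = x₀ then a₁ else a₀) * P x +
          (if x = x₀ then b₁ else b₀) * Q x) =
          ∑ x ∈ Finset.univ.erase x₀, (a₀ * P x + b₀ * Q x) := by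
        refine Finset.sum_congr rfl fun x hx => ?_
        rw [if_neg (Finset.ne_of_mem_erase hx), if_neg (Finset.ne_of_mem_erase hx)]
      simp only [this, if_true, hQ0]
      linarith

theorem le_renyiDiv_of_isMinorant {α : ℝ} (hα : 0 < α) {X : Type*} [Fintype X] {P Q : X → ℝ}
    (hP : ∀ x, 0 ≤ P x) (hQ : ∀ x, 0 ≤ Q x) (hs : ∑ x, P x = 1) {c : ℝ} {a b : X → ℝ}
    (hab : ∀ x, IsMinorant α (a x) (b x))
    (h : renyiLevel α c ≤ ∑ x, (a x * P x + b x * Q x)) : (c : EReal) ≤ renyiDiv α P Q := by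
  rw [le_renyiDiv_iff hα hP hQ hs]
  by_cases hac : 1 ≤ α → ∀ x, Q x = 0 → P x = 0
  · exact Or.inr (h.trans (Finset.sum_le_sum fun x _ =>
      hab x _ _ (hP x) (hQ x) fun h1 => hac h1 x))
  · push Not at hac
    refine Or.inl ⟨hac.1, ?_⟩
    push Not
    exact hac.2

/-! ### The chain rule for conditional distributions -/

theorem renyiDiv_comp_equiv (α : ℝ) {X Y : Type*} [Fintype X] [Fintype Y] (e : X ≃ Y)
    (P Q : Y → ℝ) : renyiDiv α (P ∘ e) (Q ∘ e) = renyiDiv α P Q := by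
  have h1 : (∀ x, Q (e x) = 0 → P (e x) = 0) ↔ ∀ y, Q y = 0 → P y = 0 :=
    e.forall_congr_right (q := fun y => Q y = 0 → P y = 0)
  have h2 : (∃ x, P (e x) ≠ 0 ∧ Q (e x) ≠ 0) ↔ ∃ y, P y ≠ 0 ∧ Q y ≠ 0 :=
    e.exists_congr_right (q := fun y => P y ≠ 0 ∧ Q y ≠ 0)
  unfold renyiDiv
  simp only [Function.comp_apply, h1, h2, ← e.sum_comp (fun y => P y * Real.log (P y / Q y)),
    ← e.sum_comp (fun y => P y ^ α * Q y ^ (1 - α))]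

/-- Conditional divergences add up: if the first marginals are at divergence at least `c`, and the
conditional distributions of the second outcome at divergence at least `d` whatever the first
outcome, then the joint distributions are at divergence at least `c + d`. -/
theorem add_le_renyiDiv_of_conditional {α : ℝ} (hα : 0 < α) {X Y : Type*} [Fintype X] [Fintype Y]
    {P Q : X → ℝ} {P' Q' : X → Y → ℝ} (hP : ∀ x, 0 ≤ P x) (hQ : ∀ x, 0 ≤ Q x)
    (hs : ∑ x, P x = 1) (hP' : ∀ x y, 0 ≤ P' x y) (hQ' : ∀ x y, 0 ≤ Q' x y)
    (hs' : ∀ x, ∑ y, P' x y = 1) {c d : ℝ} (hc : (c : EReal) ≤ renyiDiv α P Q)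
    (hd : ∀ x, (d : EReal) ≤ renyiDiv α (P' x) (Q' x)) :
    ((c + d : ℝ) : EReal) ≤ renyiDiv α (fun z : X × Y => P z.1 * P' z.1 z.2)
      (fun z : X × Y => Q z.1 * Q' z.1 z.2) := by
  have hsum : ∑ z : X × Y, P z.1 * P' z.1 z.2 = 1 := by
    rw [Fintype.sum_prod_type]
    simp_rw [← Finset.mul_sum, hs', mul_one, hs]
  rw [le_renyiDiv_iff hα (fun z => mul_nonneg (hP _) (hP' _ _))
    (fun z => mul_nonneg (hQ _) (hQ' _ _)) hsum]
  by_cases hac : 1 ≤ α → ∀ z : X × Y, Q z.1 * Q' z.1 z.2 = 0 → P z.1 * P' z.1 z.2 = 0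
  swap
  · push Not at hac
    refine Or.inl ⟨hac.1, ?_⟩
    push Not
    exact hac.2
  right
  -- Absolute continuity passes to the marginal and to the conditional distributions.
  have hac1 : 1 ≤ α → ∀ x, Q x = 0 → P x = 0 := by
    intro h1 x hx
    have h2 : ∑ y, P x * P' x y = 0 :=
      Finset.sum_eq_zero fun y _ => hac h1 (x, y) (by simp [hx])
    rwa [← Finset.mul_sum, hs', mul_one] at h2
  have hac2 : 1 ≤ α → ∀ x, P x ≠ 0 → ∀ y, Q' x y = 0 → P' x y = 0 := by
    intro h1 x hx y hy
    have := hac h1 (x, y) (by simp [hy])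
    exact (mul_eq_zero.1 this).resolve_left hx
  have hc' : renyiLevel α c ≤ ∑ x, renyiTerm α (P x) (Q x) := by
    rcases (le_renyiDiv_iff hα hP hQ hs c).1 hc with h | h
    · exact absurd (hac1 h.1) h.2
    · exact h
  have hd' : ∀ x, P x ≠ 0 → renyiLevel α d ≤ ∑ y, renyiTerm α (P' x y) (Q' x y) := by
    intro x hx
    rcases (le_renyiDiv_iff hα (hP' x) (hQ' x) (hs' x) d).1 (hd x) with h | h
    · exact absurd (hac2 h.1 x hx) h.2
    · exact h
  rw [Fintype.sum_prod_type]
  unfold renyiLevel renyiTerm at *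
  have hmul : ∀ x y, (P x * P' x y) ^ α * (Q x * Q' x y) ^ (1 - α) =
      (P x ^ α * Q x ^ (1 - α)) * (P' x y ^ α * Q' x y ^ (1 - α)) := by
    intro x y
    rw [Real.mul_rpow (hP x) (hP' x y), Real.mul_rpow (hQ x) (hQ' x y)]
    ring
  have hnn : ∀ x, 0 ≤ P x ^ α * Q x ^ (1 - α) := fun x =>
    mul_nonneg (Real.rpow_nonneg (hP x) _) (Real.rpow_nonneg (hQ x) _)
  rcases lt_trichotomy α 1 with h | rfl | h
  · simp only [h.ne, if_false, h, if_true, Finset.sum_neg_distrib, neg_le_neg_iff, hmul,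
      ← Finset.mul_sum] at *
    calc ∑ x, P x ^ α * Q x ^ (1 - α) * ∑ y, P' x y ^ α * Q' x y ^ (1 - α)
        ≤ ∑ x, P x ^ α * Q x ^ (1 - α) * Real.exp ((α - 1) * d) := by
          refine Finset.sum_le_sum fun x _ => ?_
          by_cases hx : P x = 0
          · simp [hx, Real.zero_rpow hα.ne']
          · exact mul_le_mul_of_nonneg_left (hd' x hx) (hnn x)
      _ ≤ Real.exp ((α - 1) * c) * Real.exp ((α - 1) * d) := by
          rw [← Finset.sum_mul]
          exact mul_le_mul_of_nonneg_right hc' (Real.exp_nonneg _)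
      _ = Real.exp ((α - 1) * (c + d)) := by rw [← Real.exp_add]; ring_nf
  · simp only [if_true] at *
    have key : ∀ x, P x * Real.log (P x / Q x) + P x * d ≤
        ∑ y, P x * P' x y * Real.log (P x * P' x y / (Q x * Q' x y)) := by
      intro x
      by_cases hx : P x = 0
      · simp [hx]
      have hQx : Q x ≠ 0 := fun h0 => hx (hac1 le_rfl x h0)
      have : ∀ y, P x * P' x y * Real.log (P x * P' x y / (Q x * Q' x y)) =
          P x * Real.log (P x / Q x) * P' x y + P x * (P' x y * Real.log (P' x y / Q' x y)) := by
        intro y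
        by_cases hy : P' x y = 0
        · simp [hy]
        have hQy : Q' x y ≠ 0 := fun h0 => hy (hac2 le_rfl x hx y h0)
        rw [mul_div_mul_comm, Real.log_mul (div_ne_zero hx hQx) (div_ne_zero hy hQy)]
        ring
      simp_rw [this]
      rw [Finset.sum_add_distrib, ← Finset.mul_sum, ← Finset.mul_sum, hs', mul_one]
      gcongr
      · exact hP x
      · exact hd' x hx
    calc c + d ≤ ∑ x, P x * Real.log (P x / Q x) + d := by gcongr
      _ = ∑ x, (P x * Real.log (P x / Q x) + P x * d) := by
          rw [Finset.sum_add_distrib, ← Finset.sum_mul, hs, one_mul]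
      _ ≤ _ := Finset.sum_le_sum fun x _ => key x
  · simp only [h.ne', if_false, not_lt.2 h.le, hmul, ← Finset.mul_sum] at *
    calc Real.exp ((α - 1) * (c + d)) = Real.exp ((α - 1) * c) * Real.exp ((α - 1) * d) := by
          rw [← Real.exp_add]; ring_nf
      _ ≤ ∑ x, P x ^ α * Q x ^ (1 - α) * Real.exp ((α - 1) * d) := by
          rw [← Finset.sum_mul]
          exact mul_le_mul_of_nonneg_right hc' (Real.exp_nonneg _)
      _ ≤ _ := by
          refine Finset.sum_le_sum fun x _ => ?_
          by_cases hx : P x = 0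
          · simp [hx, Real.zero_rpow hα.ne']
          · exact mul_le_mul_of_nonneg_left (hd' x hx) (hnn x)

/-! ### Convex sets of functions on a compact convex set -/

/-- Minimax theorem for a convex set `F` of continuous convex functions on a compact convex set `K`:
if every point of `K` has a function of `F` exceeding `c` there, then a single function of `F`
exceeds `c` on all of `K`. -/
theorem exists_forall_lt_of_convex {V : Type*} [TopologicalSpace V] [AddCommGroup V] [Module ℝ V]
    [IsTopologicalAddGroup V] [ContinuousSMul ℝ V] {K : Set V} (hne : K.Nonempty)
    (hK : IsCompact K) (hKc : Convex ℝ K) {F : Set (V → ℝ)} (hF : Convex ℝ F)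
    (hcont : ∀ f ∈ F, Continuous f) (hconv : ∀ f ∈ F, ConvexOn ℝ K f) {c : ℝ}
    (h : ∀ x ∈ K, ∃ f ∈ F, c < f x) : ∃ f ∈ F, ∀ x ∈ K, c < f x := by
  choose! φ hφ hlt using h
  obtain ⟨t, htK, hcov⟩ := hK.elim_nhds_subcover (fun x => {y | c < φ x y}) fun x hx =>
    (isOpen_lt continuous_const (hcont _ (hφ x hx))).mem_nhds (hlt x hx)
  refine Sion.exists_lt_iInf_of_lt_iInf_of_finite (f := fun x f => f x) (s := φ '' t) hne hK
    (fun f hf => (hcont f hf).lowerSemicontinuous.lowerSemicontinuousOn _)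
    (fun f hf => (hconv f hf).quasiconvexOn) hF
    (fun x _ => (continuous_apply x).upperSemicontinuous.upperSemicontinuousOn _)
    (fun x _ => ConcaveOn.quasiconcaveOn ⟨hF, fun _ _ _ _ _ _ _ _ _ => le_rfl⟩) hKc
    (t.finite_toSet.image φ) ?_ ?_
  · rintro _ ⟨x, hx, rfl⟩
    exact hφ x (htK x hx)
  · intro x hx
    obtain ⟨y, hy, hxy⟩ := Set.mem_iUnion₂.1 (hcov hx)
    exact ⟨φ y, ⟨y, hy, rfl⟩, hxy⟩

/-! ### Density operators -/

section Density

variable {n : Type*} [Fintype n] [DecidableEq n]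

theorem exists_eq_conjTranspose_mul_self {X : Matrix n n ℂ} (hX : X.PosSemidef) :
    ∃ G : Matrix n n ℂ, X = Gᴴ * G := by
  open scoped Matrix.Norms.L2Operator MatrixOrder in
  exact nonneg_iff_exists_star_mul_self.1 hX.nonneg

theorem trace_mul_nonneg {X Y : Matrix n n ℂ} (hX : X.PosSemidef) (hY : Y.PosSemidef) :
    0 ≤ (X * Y).trace := by
  obtain ⟨G, rfl⟩ := exists_eq_conjTranspose_mul_self hY
  rw [← Matrix.mul_assoc, Matrix.trace_mul_comm, ← Matrix.mul_assoc]
  exact (hX.mul_mul_conjTranspose_same G).trace_nonneg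

theorem convex_densityOps : Convex ℝ (densityOps n) := by
  rintro ρ ⟨hρ, hρ'⟩ σ ⟨hσ, hσ'⟩ a b ha hb hab
  refine ⟨(hρ.smul ha).add (hσ.smul hb), ?_⟩
  rw [Matrix.trace_add, Matrix.trace_smul, Matrix.trace_smul, hρ', hσ', ← add_smul, hab, one_smul]

theorem trace_conjTranspose_mul_self (G : Matrix n n ℂ) :
    (Gᴴ * G).trace = ((∑ i, ∑ j, ‖G i j‖ ^ 2 : ℝ) : ℂ) := by
  simp only [Matrix.trace, Matrix.diag, Matrix.mul_apply, Matrix.conjTranspose_apply]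
  rw [Finset.sum_comm]
  push_cast
  refine Finset.sum_congr rfl fun i _ => Finset.sum_congr rfl fun j _ => ?_
  exact Complex.conj_mul' _

/-- The density operators are the matrices `Gᴴ * G` with `G` in the Frobenius unit sphere. -/
theorem isCompact_densityOps : IsCompact (densityOps n) := by
  have hS : IsCompact {G : Matrix n n ℂ | ∑ i, ∑ j, ‖G i j‖ ^ 2 = 1} := by
    have hbox : IsCompact (Set.univ.pi fun _ : n => Set.univ.pi fun _ : n =>
        Metric.closedBall (0 : ℂ) 1) :=
      isCompact_univ_pi fun _ => isCompact_univ_pi fun _ => isCompact_closedBall _ _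
    refine IsCompact.of_isClosed_subset hbox (isClosed_eq ?_ continuous_const) ?_
    · exact continuous_finsetSum _ fun i _ => continuous_finsetSum _ fun j _ =>
        ((continuous_apply_apply i j).norm).pow 2
    · intro G hG i _ j _
      rw [mem_closedBall_zero_iff]
      have h1 : ‖G i j‖ ^ 2 ≤ ∑ j, ‖G i j‖ ^ 2 :=
        Finset.single_le_sum (f := fun j => ‖G i j‖ ^ 2) (fun _ _ => by positivity)
          (Finset.mem_univ j)
      have h2 : ∑ j, ‖G i j‖ ^ 2 ≤ ∑ i, ∑ j, ‖G i j‖ ^ 2 :=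
        Finset.single_le_sum (f := fun i => ∑ j, ‖G i j‖ ^ 2)
          (fun _ _ => Finset.sum_nonneg fun _ _ => by positivity) (Finset.mem_univ i)
      have h3 : ‖G i j‖ ^ 2 ≤ 1 ^ 2 := by
        rw [one_pow]
        exact (h1.trans h2).trans_eq hG
      exact (sq_le_sq₀ (norm_nonneg _) zero_le_one).1 h3
  have himg : densityOps n = (fun G : Matrix n n ℂ => Gᴴ * G) ''
      {G : Matrix n n ℂ | ∑ i, ∑ j, ‖G i j‖ ^ 2 = 1} := by
    ext ρ
    constructor
    · rintro ⟨hρ, htr⟩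
      obtain ⟨G, rfl⟩ := exists_eq_conjTranspose_mul_self hρ
      rw [trace_conjTranspose_mul_self] at htr
      exact ⟨G, by exact_mod_cast htr, rfl⟩
    · rintro ⟨G, hG, rfl⟩
      refine ⟨Matrix.posSemidef_conjTranspose_mul_self G, ?_⟩
      rw [trace_conjTranspose_mul_self, hG, Complex.ofReal_one]
  rw [himg]
  exact hS.image (by fun_prop)

theorem densityOps_nonempty [Nonempty n] : (densityOps n).Nonempty := by
  obtain ⟨i⟩ := ‹Nonempty n›
  refine ⟨Matrix.diagonal (Pi.single i 1), Matrix.PosSemidef.diagonal ?_, ?_⟩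
  · exact Pi.single_nonneg.2 zero_le_one
  · simp [Matrix.trace_diagonal]

/-- A positive semidefinite operator is a nonnegative multiple of a state, also if it is zero. -/
theorem exists_eq_smul_densityOps [Nonempty n] {X : Matrix n n ℂ} (hX : X.PosSemidef) :
    ∃ τ ∈ densityOps n, X = X.trace.re • τ := by
  have hre : ((X.trace.re : ℝ) : ℂ) = X.trace := (Complex.eq_re_of_ofReal_le
    (r := 0) (by simpa using hX.trace_nonneg)).symm
  by_cases h0 : X.trace = 0
  · obtain ⟨τ, hτ⟩ := densityOps_nonempty (n := n)
    refine ⟨τ, hτ, ?_⟩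
    rw [h0, hX.trace_eq_zero_iff.1 h0]
    simp
  · have hne : X.trace.re ≠ 0 := fun h => h0 (by rw [← hre, h, Complex.ofReal_zero])
    refine ⟨X.trace.re⁻¹ • X, ⟨hX.smul ?_, ?_⟩, ?_⟩
    · exact inv_nonneg.2 (Complex.nonneg_iff.1 hX.trace_nonneg).1
    · rw [Matrix.trace_smul, Complex.real_smul, Complex.ofReal_inv, hre, inv_mul_cancel₀ h0]
    · rw [smul_smul, mul_inv_cancel₀ hne, one_smul]

end Density

/-! ### Measurement outcomes -/

section Outcome

variable {n : Type*} [Fintype n] {k : ℕ}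

theorem outcome_add (Λ : Fin k → Matrix n n ℂ) (X Y : Matrix n n ℂ) :
    outcome Λ (X + Y) = outcome Λ X + outcome Λ Y := by
  ext x
  simp [outcome, Matrix.mul_add]

theorem outcome_smul (Λ : Fin k → Matrix n n ℂ) (s : ℝ) (X : Matrix n n ℂ) :
    outcome Λ (s • X) = s • outcome Λ X := by
  ext x
  simp [outcome]

variable [DecidableEq n] {Λ : Fin k → Matrix n n ℂ}

theorem IsPOVM.outcome_nonneg (hΛ : IsPOVM Λ) {X : Matrix n n ℂ} (hX : X.PosSemidef) (x : Fin k) :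
    0 ≤ outcome Λ X x :=
  (Complex.nonneg_iff.1 (trace_mul_nonneg (hΛ.1 x) hX)).1

theorem IsPOVM.sum_outcome (hΛ : IsPOVM Λ) (X : Matrix n n ℂ) :
    ∑ x, outcome Λ X x = X.trace.re := by
  simp only [outcome]
  rw [← Complex.re_sum, ← Matrix.trace_sum, ← Finset.sum_mul, hΛ.2, one_mul]

/-- Two measurements can be mixed: one of them is chosen at random and the choice is recorded. -/
theorem IsPOVM.append {l : ℕ} {Λ' : Fin l → Matrix n n ℂ} (hΛ : IsPOVM Λ) (hΛ' : IsPOVM Λ')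
    {s t : ℝ} (hs : 0 ≤ s) (ht : 0 ≤ t) (hst : s + t = 1) :
    IsPOVM (Fin.append (s • Λ) (t • Λ')) := by
  refine ⟨fun x => ?_, ?_⟩
  · refine Fin.addCases (fun i => ?_) (fun i => ?_) x
    · rw [Fin.append_left]
      exact (hΛ.1 i).smul hs
    · rw [Fin.append_right]
      exact (hΛ'.1 i).smul ht
  · simp only [Fin.sum_univ_add, Fin.append_left, Fin.append_right, Pi.smul_apply]
    rw [← Finset.smul_sum, ← Finset.smul_sum, hΛ.2, hΛ'.2, ← add_smul, hst, one_smul]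

/-- Outcomes and basis vectors of a measurement can be relabelled. -/
theorem IsPOVM.reindex {m : Type*} [Fintype m] [DecidableEq m] {X : Type*} [Fintype X] {l : ℕ}
    {Γ : X → Matrix n n ℂ} (hΓ : ∀ x, (Γ x).PosSemidef) (hsum : ∑ x, Γ x = 1) (e : m ≃ n)
    (f : Fin l ≃ X) : IsPOVM fun i => (Γ (f i)).submatrix e e := by
  refine ⟨fun i => (hΓ _).submatrix e, ?_⟩
  rw [f.sum_comp fun x => (Γ x).submatrix e e]
  ext a b
  have := congrFun (congrFun hsum (e a)) (e b)
  rw [Matrix.sum_apply] at this ⊢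
  simp only [Matrix.submatrix_apply, this, Matrix.one_apply, e.injective.eq_iff]

end Outcome

/-! ### The output of a jammed channel -/

section Output

variable {A E B R : Type*} [Fintype A] [DecidableEq A] [Fintype E] [DecidableEq E] [Fintype B]
  [DecidableEq B] [Fintype R] [DecidableEq R]

/-- `jammedOutput`, as a bilinear map of the input state and the jammer state. -/
noncomputable def jammedOutputBilin (N : Matrix (A × E) (A × E) ℂ →ₗ[ℂ] Matrix B B ℂ) :
    Matrix (A × R) (A × R) ℂ →ₗ[ℂ] Matrix E E ℂ →ₗ[ℂ] Matrix (B × R) (B × R) ℂ :=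
  LinearMap.mk₂ ℂ (jammedOutput N)
    (fun ρ ρ' σ => by
      simp only [jammedOutput, Matrix.add_kronecker, Matrix.submatrix_add, Pi.add_apply, map_add])
    (fun c ρ σ => by
      simp only [jammedOutput, Matrix.smul_kronecker, Matrix.submatrix_smul, Pi.smul_apply,
        map_smul])
    (fun ρ σ σ' => by
      simp only [jammedOutput, Matrix.kronecker_add, Matrix.submatrix_add, Pi.add_apply, map_add])
    (fun c ρ σ => by
      simp only [jammedOutput, Matrix.kronecker_smul, Matrix.submatrix_smul, Pi.smul_apply,
        map_smul])

theorem jammedOutputBilin_apply (N : Matrix (A × E) (A × E) ℂ →ₗ[ℂ] Matrix B B ℂ)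
    (ρ : Matrix (A × R) (A × R) ℂ) (σ : Matrix E E ℂ) :
    jammedOutputBilin N ρ σ = jammedOutput N ρ σ := rfl

theorem jammedOutput_posSemidef {N : Matrix (A × E) (A × E) ℂ →ₗ[ℂ] Matrix B B ℂ} (hN : IsCP N)
    {r : ℕ} {ρ : Matrix (A × Fin r) (A × Fin r) ℂ} (hρ : ρ.PosSemidef) {σ : Matrix E E ℂ}
    (hσ : σ.PosSemidef) : (jammedOutput N ρ σ).PosSemidef :=
  (isCP_iff N).1 hN r _ ((hρ.kronecker hσ).submatrix _)

theorem trace_jammedOutput {N : Matrix (A × E) (A × E) ℂ →ₗ[ℂ] Matrix B B ℂ}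
    (hN : ∀ X, (N X).trace = X.trace) {r : ℕ} (ρ : Matrix (A × Fin r) (A × Fin r) ℂ)
    (σ : Matrix E E ℂ) : (jammedOutput N ρ σ).trace = ρ.trace * σ.trace := by
  have h : ∀ X : Matrix ((A × E) × Fin r) ((A × E) × Fin r) ℂ,
      (tensorMap N LinearMap.id X).trace = X.trace := by
    intro X
    have : ∀ i, ∑ b, N (Matrix.of fun a a' => X (a, i) (a', i)) b b = ∑ a, X (a, i) (a, i) :=
      fun i => hN (Matrix.of fun a a' => X (a, i) (a', i))
    simp only [Matrix.trace, Matrix.diag, tensorMap_id_apply, Fintype.sum_prod_type_right, this]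
  rw [jammedOutput, h, ← Matrix.trace_kronecker]
  simp only [Matrix.trace, Matrix.diag, Matrix.submatrix_apply, Fintype.sum_prod_type]
  exact Finset.sum_congr rfl fun a _ => Finset.sum_comm

variable {r k : ℕ} {N M : Matrix (A × E) (A × E) ℂ →ₗ[ℂ] Matrix B B ℂ}
  {ρ : Matrix (A × Fin r) (A × Fin r) ℂ}

theorem outcome_jammedOutput_add (Λ : Fin k → Matrix (B × Fin r) (B × Fin r) ℂ)
    (σ σ' : Matrix E E ℂ) : outcome Λ (jammedOutput N ρ (σ + σ')) =
      outcome Λ (jammedOutput N ρ σ) + outcome Λ (jammedOutput N ρ σ') := by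
  rw [← outcome_add]
  exact congrArg _ (map_add (jammedOutputBilin N ρ) σ σ')

theorem outcome_jammedOutput_smul (Λ : Fin k → Matrix (B × Fin r) (B × Fin r) ℂ) (s : ℝ)
    (σ : Matrix E E ℂ) : outcome Λ (jammedOutput N ρ (s • σ)) =
      s • outcome Λ (jammedOutput N ρ σ) := by
  rw [← outcome_smul]
  exact congrArg _ (LinearMap.map_smul_of_tower (jammedOutputBilin N ρ) s σ)

theorem continuous_outcome_jammedOutput (N : Matrix (A × E) (A × E) ℂ →ₗ[ℂ] Matrix B B ℂ)
    (ρ : Matrix (A × Fin r) (A × Fin r) ℂ) (Λ : Fin k → Matrix (B × Fin r) (B × Fin r) ℂ)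
    (x : Fin k) : Continuous fun σ : Matrix E E ℂ => outcome Λ (jammedOutput N ρ σ) x := by
  have h : Continuous fun σ : Matrix E E ℂ => jammedOutput N ρ σ :=
    (jammedOutputBilin N ρ).continuous_of_finiteDimensional
  exact Complex.continuous_re.comp (continuous_const.matrix_mul h).matrix_trace

/-- A lower bound on the measured divergence, uniform in the jammer states, can be achieved (up to
an arbitrarily small loss) by a measurement that does not depend on the jammer states. -/
theorem exists_povm_of_lt_iInf [Nonempty E] {α : ℝ} (hα : 0 < α) (hN : IsCPTP N) (hM : IsCP M)
    (hρ : ρ ∈ densityOps (A × Fin r)) {c : ℝ}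
    (hc : (c : EReal) < ⨅ (σ ∈ densityOps E) (ω ∈ densityOps E),
      measuredRenyi α (jammedOutput N ρ σ) (jammedOutput M ρ ω)) :
    ∃ (k : ℕ) (Λ : Fin k → Matrix (B × Fin r) (B × Fin r) ℂ), IsPOVM Λ ∧
      ∀ σ ∈ densityOps E, ∀ ω ∈ densityOps E,
        (c : EReal) ≤ renyiDiv α (outcome Λ (jammedOutput N ρ σ))
          (outcome Λ (jammedOutput M ρ ω)) := by
  have hPnn : ∀ {k : ℕ} {Λ : Fin k → Matrix (B × Fin r) (B × Fin r) ℂ}, IsPOVM Λ →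
      ∀ {σ : Matrix E E ℂ}, σ ∈ densityOps E → ∀ x, 0 ≤ outcome Λ (jammedOutput N ρ σ) x :=
    fun hΛ _ hσ => hΛ.outcome_nonneg (jammedOutput_posSemidef hN.1 hρ.1 hσ.1)
  have hQnn : ∀ {k : ℕ} {Λ : Fin k → Matrix (B × Fin r) (B × Fin r) ℂ}, IsPOVM Λ →
      ∀ {ω : Matrix E E ℂ}, ω ∈ densityOps E → ∀ x, 0 ≤ outcome Λ (jammedOutput M ρ ω) x :=
    fun hΛ _ hω => hΛ.outcome_nonneg (jammedOutput_posSemidef hM hρ.1 hω.1)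
  have hPsum : ∀ {k : ℕ} {Λ : Fin k → Matrix (B × Fin r) (B × Fin r) ℂ}, IsPOVM Λ →
      ∀ {σ : Matrix E E ℂ}, σ ∈ densityOps E → ∑ x, outcome Λ (jammedOutput N ρ σ) x = 1 := by
    intro k Λ hΛ σ hσ
    rw [hΛ.sum_outcome, trace_jammedOutput hN.2, hρ.2, hσ.2]
    simp
  -- A measurement together with a minorant for each outcome is an affine function of the jammer
  -- states; recording the choice of the measurement makes these functions a convex set.
  let F : Set (Matrix E E ℂ × Matrix E E ℂ → ℝ) := {f | ∃ (k : ℕ)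
    (Λ : Fin k → Matrix (B × Fin r) (B × Fin r) ℂ) (a b : Fin k → ℝ), IsPOVM Λ ∧
      (∀ x, IsMinorant α (a x) (b x)) ∧ f = fun p => ∑ x, (a x * outcome Λ (jammedOutput N ρ p.1) x
        + b x * outcome Λ (jammedOutput M ρ p.2) x)}
  have hF : Convex ℝ F := by
    rintro _ ⟨k, Λ, a, b, hΛ, hab, rfl⟩ _ ⟨l, Λ', a', b', hΛ', hab', rfl⟩ s t hs ht hst
    refine ⟨k + l, _, Fin.append a a', Fin.append b b', hΛ.append hΛ' hs ht hst, fun x => ?_, ?_⟩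
    · refine Fin.addCases (fun i => ?_) (fun i => ?_) x
      · simpa only [Fin.append_left] using hab i
      · simpa only [Fin.append_right] using hab' i
    · ext p
      simp only [Fin.sum_univ_add, Fin.append_left, Fin.append_right, Pi.add_apply, Pi.smul_apply,
        outcome, smul_eq_mul, Finset.mul_sum, Matrix.smul_mul, Matrix.trace_smul, Complex.smul_re]
      congr 1 <;> exact Finset.sum_congr rfl fun x _ => by ring
  obtain ⟨σ₀, hσ₀⟩ := densityOps_nonempty (n := E)
  have hKc : Convex ℝ (densityOps E ×ˢ densityOps E) := convex_densityOps.prod convex_densityOps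
  obtain ⟨f, ⟨k, Λ, a, b, hΛ, hab, rfl⟩, hf⟩ := exists_forall_lt_of_convex (c := renyiLevel α c)
    (K := densityOps E ×ˢ densityOps E) ⟨(σ₀, σ₀), hσ₀, hσ₀⟩
    (isCompact_densityOps.prod isCompact_densityOps) hKc hF (by
      rintro _ ⟨k, Λ, a, b, -, -, rfl⟩
      refine continuous_finsetSum _ fun x _ => ?_
      exact ((continuous_outcome_jammedOutput N ρ Λ x).comp continuous_fst |>.const_mul _).add
        ((continuous_outcome_jammedOutput M ρ Λ x).comp continuous_snd |>.const_mul _))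
    (by
      rintro _ ⟨k, Λ, a, b, -, -, rfl⟩
      refine ⟨hKc, fun p _ q _ s t _ _ _ => le_of_eq ?_⟩
      simp only [Prod.fst_add, Prod.snd_add, Prod.smul_fst, Prod.smul_snd,
        outcome_jammedOutput_add, outcome_jammedOutput_smul, Pi.add_apply, Pi.smul_apply,
        smul_eq_mul, Finset.mul_sum]
      rw [← Finset.sum_add_distrib]
      exact Finset.sum_congr rfl fun x _ => by ring)
    (by
      rintro ⟨σ, ω⟩ ⟨hσ, hω⟩
      have h1 : (c : EReal) < measuredRenyi α (jammedOutput N ρ σ) (jammedOutput M ρ ω) :=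
        hc.trans_le (iInf₂_le_of_le σ hσ (iInf₂_le ω hω))
      simp only [measuredRenyi, lt_iSup_iff] at h1
      obtain ⟨k, Λ, hΛ, h1⟩ := h1
      obtain ⟨a, b, hab, h2⟩ := exists_isMinorant_of_lt_renyiDiv hα (hPnn hΛ hσ) (hQnn hΛ hω)
        (hPsum hΛ hσ) h1
      exact ⟨_, ⟨k, Λ, a, b, hΛ, hab, rfl⟩, h2⟩)
  exact ⟨k, Λ, hΛ, fun σ hσ ω hω => le_renyiDiv_of_isMinorant hα (hPnn hΛ hσ) (hQnn hΛ hω)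
    (hPsum hΛ hσ) hab (hf (σ, ω) ⟨hσ, hω⟩).le⟩

end Output

/-! ### Slices of operators on a tensor product -/

section Slice

variable {m n : Type*} [Fintype m] [DecidableEq m] [Fintype n] [DecidableEq n]

/-- Product operators span, so an additive property has to be checked only on them. -/
theorem kronecker_induction {p : Matrix (m × n) (m × n) ℂ → Prop}
    (kron : ∀ (X : Matrix m m ℂ) (Y : Matrix n n ℂ), p (X ⊗ₖ Y))
    (add : ∀ Z Z', p Z → p Z' → p (Z + Z')) (Z : Matrix (m × n) (m × n) ℂ) : p Z := by
  obtain ⟨t, rfl⟩ := (kroneckerLinearEquiv m m n n ℂ).surjective Z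
  induction t using TensorProduct.induction_on with
  | zero =>
    rw [map_zero, ← Matrix.zero_kronecker (0 : Matrix n n ℂ)]
    exact kron 0 0
  | tmul X Y => exact kron X Y
  | add s t hs ht =>
    rw [map_add]
    exact add _ _ hs ht

/-- The slice map `g ⊗ id` of a linear functional `g` on the operators of the first system. -/
noncomputable def slice (g : Matrix m m ℂ →ₗ[ℂ] ℂ) :
    Matrix (m × n) (m × n) ℂ →ₗ[ℂ] Matrix n n ℂ where
  toFun Z := Matrix.of fun e e' => g (Matrix.of fun a a' => Z (a, e) (a', e'))
  map_add' Z Z' := by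
    ext e e'
    simp only [Matrix.of_apply, Matrix.add_apply, ← map_add]
    rfl
  map_smul' c Z := by
    ext e e'
    simp only [Matrix.of_apply, Matrix.smul_apply, RingHom.id_apply, ← map_smul]
    rfl

theorem slice_kronecker (g : Matrix m m ℂ →ₗ[ℂ] ℂ) (X : Matrix m m ℂ) (Y : Matrix n n ℂ) :
    slice g (X ⊗ₖ Y) = g X • Y := by
  ext e e'
  have : (Matrix.of fun a a' => (X ⊗ₖ Y) (a, e) (a', e')) = Y e e' • X := by
    ext a a'
    simp [mul_comm]
  simp only [slice, LinearMap.coe_mk, AddHom.coe_mk, Matrix.of_apply, this, map_smul,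
    Matrix.smul_apply, smul_eq_mul]
  ring

/-- The partial trace over the second system. -/
def partialTrace (Z : Matrix (m × n) (m × n) ℂ) : Matrix m m ℂ :=
  ∑ e, Z.submatrix (fun a => (a, e)) (fun a => (a, e))

theorem trace_slice (g : Matrix m m ℂ →ₗ[ℂ] ℂ) (Z : Matrix (m × n) (m × n) ℂ) :
    (slice g Z).trace = g (partialTrace Z) := by
  rw [partialTrace, map_sum]
  rfl

theorem partialTrace_mem_densityOps {Z : Matrix (m × n) (m × n) ℂ} (hZ : Z ∈ densityOps (m × n)) :
    partialTrace Z ∈ densityOps m := by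
  refine ⟨Matrix.posSemidef_sum _ fun e _ => hZ.1.submatrix _, ?_⟩
  rw [partialTrace, Matrix.trace_sum, ← hZ.2]
  simp only [Matrix.trace, Matrix.diag, Matrix.submatrix_apply, Fintype.sum_prod_type_right]

theorem posSemidef_of_dotProduct_nonneg {X : Matrix n n ℂ}
    (h : ∀ v : n → ℂ, 0 ≤ star v ⬝ᵥ X *ᵥ v) : X.PosSemidef := by
  rw [← Matrix.isPositive_toEuclideanLin_iff, LinearMap.isPositive_iff_complex]
  intro v
  have hv := Complex.nonneg_iff.1 (h v.ofLp)
  have : inner ℂ (Matrix.toEuclideanLin X v) v = star (star v.ofLp ⬝ᵥ X *ᵥ v.ofLp) := by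
    rw [← inner_conj_symm, EuclideanSpace.inner_eq_star_dotProduct, dotProduct_comm]
    rfl
  rw [this]
  refine ⟨Complex.ext ?_ ?_, ?_⟩
  · simp
  · simp [← hv.2]
  · simpa using hv.1

/-- The slices of a positive semidefinite operator along a positive functional are positive
semidefinite: their quadratic form at `v` is the functional at a compression by `v`. -/
theorem slice_posSemidef {g : Matrix m m ℂ →ₗ[ℂ] ℂ} (hg : ∀ Y, Y.PosSemidef → 0 ≤ g Y)
    {Z : Matrix (m × n) (m × n) ℂ} (hZ : Z.PosSemidef) : (slice g Z).PosSemidef := by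
  refine posSemidef_of_dotProduct_nonneg fun v => ?_
  let V : Matrix (m × n) m ℂ := Matrix.of fun x a => if x.1 = a then v x.2 else 0
  have hW := hg _ (hZ.conjTranspose_mul_mul_same V)
  have hV : Vᴴ * Z * V = ∑ e, ∑ e', (star (v e) * v e') •
      Matrix.of fun a a' => Z (a, e) (a', e') := by
    ext a a'
    simp only [V, Matrix.mul_apply, Matrix.conjTranspose_apply, Matrix.of_apply, Matrix.sum_apply,
      Matrix.smul_apply, Fintype.sum_prod_type, apply_ite star, star_zero, ite_mul, zero_mul,
      mul_ite, mul_zero, Finset.sum_ite_irrel, Finset.sum_const_zero, Finset.sum_ite_eq',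
      Finset.mem_univ, if_true, smul_eq_mul, Finset.sum_mul]
    rw [Finset.sum_comm]
    exact Finset.sum_congr rfl fun e _ => Finset.sum_congr rfl fun e' _ => by ring
  rw [hV] at hW
  simp only [map_sum, map_smul, smul_eq_mul] at hW
  refine hW.trans_eq ?_
  simp only [dotProduct, mulVec, slice, LinearMap.coe_mk, AddHom.coe_mk, Matrix.of_apply,
    Pi.star_apply, Finset.mul_sum]
  exact Finset.sum_congr rfl fun e _ => Finset.sum_congr rfl fun e' _ => by ring

end Slice

/-! ### Super-additivity -/

section Factor

variable {A E B A₁ E₁ B₁ A₂ E₂ B₂ : Type*}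
  [Fintype A] [DecidableEq A] [Fintype E] [DecidableEq E] [Fintype B] [DecidableEq B]
  [Fintype A₁] [DecidableEq A₁] [Fintype E₁] [DecidableEq E₁] [Fintype B₁] [DecidableEq B₁]
  [Fintype A₂] [DecidableEq A₂] [Fintype E₂] [DecidableEq E₂] [Fintype B₂] [DecidableEq B₂]

/-- Up to the identifications `A ≃ A₁A₂`, `E ≃ E₁E₂` and `B ≃ B₁B₂`, the map `N` is the tensor
product of `N₁` and `N₂`. -/
def Factors (eA : A ≃ A₁ × A₂) (eE : E ≃ E₁ × E₂) (eB : B ≃ B₁ × B₂)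
    (N : Matrix (A × E) (A × E) ℂ →ₗ[ℂ] Matrix B B ℂ)
    (N₁ : Matrix (A₁ × E₁) (A₁ × E₁) ℂ →ₗ[ℂ] Matrix B₁ B₁ ℂ)
    (N₂ : Matrix (A₂ × E₂) (A₂ × E₂) ℂ →ₗ[ℂ] Matrix B₂ B₂ ℂ) : Prop :=
  ∀ X₁ X₂ Y₁ Y₂, N (((X₁ ⊗ₖ X₂).submatrix eA eA) ⊗ₖ ((Y₁ ⊗ₖ Y₂).submatrix eE eE)) =
    (N₁ (X₁ ⊗ₖ Y₁) ⊗ₖ N₂ (X₂ ⊗ₖ Y₂)).submatrix eB eB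

/-- The identification of systems `AR ≃ (A₁R₁)(A₂R₂)` that collects the references of the factors
in one reference system. -/
def pairEquiv (eA : A ≃ A₁ × A₂) (r₁ r₂ : ℕ) :
    A × Fin (r₁ * r₂) ≃ (A₁ × Fin r₁) × (A₂ × Fin r₂) :=
  (eA.prodCongr finProdFinEquiv.symm).trans (Equiv.prodProdProdComm A₁ A₂ (Fin r₁) (Fin r₂))

theorem pairEquiv_submatrix (eA : A ≃ A₁ × A₂) {r₁ r₂ : ℕ} (X₁ : Matrix A₁ A₁ ℂ)
    (X₂ : Matrix A₂ A₂ ℂ) (T₁ : Matrix (Fin r₁) (Fin r₁) ℂ) (T₂ : Matrix (Fin r₂) (Fin r₂) ℂ) :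
    ((X₁ ⊗ₖ T₁) ⊗ₖ (X₂ ⊗ₖ T₂)).submatrix (pairEquiv eA r₁ r₂) (pairEquiv eA r₁ r₂) =
      (X₁ ⊗ₖ X₂).submatrix eA eA ⊗ₖ
        (T₁ ⊗ₖ T₂).submatrix finProdFinEquiv.symm finProdFinEquiv.symm := by
  ext x y
  simp only [pairEquiv, Matrix.submatrix_apply, Matrix.kroneckerMap_apply, Equiv.trans_apply,
    Equiv.prodCongr_apply, Prod.map, Equiv.prodProdProdComm_apply]
  ring

variable {eA : A ≃ A₁ × A₂} {eE : E ≃ E₁ × E₂} {eB : B ≃ B₁ × B₂}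
  {N : Matrix (A × E) (A × E) ℂ →ₗ[ℂ] Matrix B B ℂ}
  {N₁ : Matrix (A₁ × E₁) (A₁ × E₁) ℂ →ₗ[ℂ] Matrix B₁ B₁ ℂ}
  {N₂ : Matrix (A₂ × E₂) (A₂ × E₂) ℂ →ₗ[ℂ] Matrix B₂ B₂ ℂ}
  {M : Matrix (A × E) (A × E) ℂ →ₗ[ℂ] Matrix B B ℂ}
  {M₁ : Matrix (A₁ × E₁) (A₁ × E₁) ℂ →ₗ[ℂ] Matrix B₁ B₁ ℂ}
  {M₂ : Matrix (A₂ × E₂) (A₂ × E₂) ℂ →ₗ[ℂ] Matrix B₂ B₂ ℂ}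

theorem Factors.jammedOutput_kronecker (h : Factors eA eE eB N N₁ N₂) {r₁ r₂ : ℕ}
    (ρ₁ : Matrix (A₁ × Fin r₁) (A₁ × Fin r₁) ℂ) (ρ₂ : Matrix (A₂ × Fin r₂) (A₂ × Fin r₂) ℂ)
    (Y₁ : Matrix E₁ E₁ ℂ) (Y₂ : Matrix E₂ E₂ ℂ) :
    jammedOutput N ((ρ₁ ⊗ₖ ρ₂).submatrix (pairEquiv eA r₁ r₂) (pairEquiv eA r₁ r₂))
        ((Y₁ ⊗ₖ Y₂).submatrix eE eE) =
      (jammedOutput N₁ ρ₁ Y₁ ⊗ₖ jammedOutput N₂ ρ₂ Y₂).submatrix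
        (pairEquiv eB r₁ r₂) (pairEquiv eB r₁ r₂) := by
  simp only [← jammedOutputBilin_apply]
  induction ρ₁ using kronecker_induction with
  | add Z Z' hZ hZ' =>
    simp only [Matrix.add_kronecker, Matrix.submatrix_add, Pi.add_apply, map_add,
      LinearMap.add_apply] at hZ hZ' ⊢
    rw [hZ, hZ']
  | kron X₁ T₁ =>
    induction ρ₂ using kronecker_induction with
    | add Z Z' hZ hZ' =>
      simp only [Matrix.kronecker_add, Matrix.submatrix_add, Pi.add_apply, map_add,
        LinearMap.add_apply] at hZ hZ' ⊢
      rw [hZ, hZ']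
    | kron X₂ T₂ =>
      simp only [jammedOutputBilin_apply, JammerChannel.jammedOutput_kronecker, pairEquiv_submatrix]
      rw [h]

/-- The functional `Y ↦ tr[Γ N(ρ ⊗ Y)]` of the jammer state. -/
noncomputable def effectFunctional (N : Matrix (A × E) (A × E) ℂ →ₗ[ℂ] Matrix B B ℂ) {r : ℕ}
    (ρ : Matrix (A × Fin r) (A × Fin r) ℂ) (Γ : Matrix (B × Fin r) (B × Fin r) ℂ) :
    Matrix E E ℂ →ₗ[ℂ] ℂ :=
  Matrix.traceLinearMap (B × Fin r) ℂ ℂ ∘ₗ LinearMap.mulLeft ℂ Γ ∘ₗ jammedOutputBilin N ρ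

theorem effectFunctional_apply (N : Matrix (A × E) (A × E) ℂ →ₗ[ℂ] Matrix B B ℂ) {r : ℕ}
    (ρ : Matrix (A × Fin r) (A × Fin r) ℂ) (Γ : Matrix (B × Fin r) (B × Fin r) ℂ)
    (Y : Matrix E E ℂ) :
    effectFunctional N ρ Γ Y = (Γ * jammedOutput N ρ Y).trace := rfl

/-- Observing the effect `Γ₁` at the first output leaves the second channel with the jammer
operator that is the slice of the joint jammer operator along `Γ₁`. -/
theorem Factors.trace_mul (h : Factors eA eE eB N N₁ N₂) {r₁ r₂ : ℕ}
    (ρ₁ : Matrix (A₁ × Fin r₁) (A₁ × Fin r₁) ℂ) (ρ₂ : Matrix (A₂ × Fin r₂) (A₂ × Fin r₂) ℂ)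
    (Γ₁ : Matrix (B₁ × Fin r₁) (B₁ × Fin r₁) ℂ) (Γ₂ : Matrix (B₂ × Fin r₂) (B₂ × Fin r₂) ℂ)
    (S : Matrix (E₁ × E₂) (E₁ × E₂) ℂ) :
    ((Γ₁ ⊗ₖ Γ₂).submatrix (pairEquiv eB r₁ r₂) (pairEquiv eB r₁ r₂) * jammedOutput N
        ((ρ₁ ⊗ₖ ρ₂).submatrix (pairEquiv eA r₁ r₂) (pairEquiv eA r₁ r₂))
        (S.submatrix eE eE)).trace =
      (Γ₂ * jammedOutput N₂ ρ₂ (slice (effectFunctional N₁ ρ₁ Γ₁) S)).trace := by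
  induction S using kronecker_induction with
  | add Z Z' hZ hZ' =>
    simp only [← jammedOutputBilin_apply, Matrix.submatrix_add, Pi.add_apply, map_add,
      Matrix.mul_add, Matrix.trace_add] at hZ hZ' ⊢
    rw [hZ, hZ']
  | kron Y₁ Y₂ =>
    have hsmul := map_smul (jammedOutputBilin N₂ ρ₂) (effectFunctional N₁ ρ₁ Γ₁ Y₁) Y₂
    simp only [jammedOutputBilin_apply] at hsmul
    rw [h.jammedOutput_kronecker, Matrix.submatrix_mul_equiv, ← Matrix.mul_kronecker_mul,
      slice_kronecker, hsmul, Matrix.mul_smul, Matrix.trace_smul, effectFunctional_apply,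
      smul_eq_mul, ← Matrix.trace_kronecker]
    exact (pairEquiv eB r₁ r₂).sum_comp fun z => ((Γ₁ * jammedOutput N₁ ρ₁ Y₁) ⊗ₖ
      (Γ₂ * jammedOutput N₂ ρ₂ Y₂)) z z

/-- Under a product measurement, the jammer state of a product channel acts as a state of the first
jammer system followed by a state of the second one that depends on the first outcome. -/
theorem Factors.exists_conditional [Nonempty E₂] (h : Factors eA eE eB N N₁ N₂) (hN₁ : IsCP N₁)
    {r₁ r₂ k₁ k₂ : ℕ} {ρ₁ : Matrix (A₁ × Fin r₁) (A₁ × Fin r₁) ℂ} (hρ₁ : ρ₁.PosSemidef)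
    (ρ₂ : Matrix (A₂ × Fin r₂) (A₂ × Fin r₂) ℂ)
    {Λ₁ : Fin k₁ → Matrix (B₁ × Fin r₁) (B₁ × Fin r₁) ℂ} (hΛ₁ : ∀ x, (Λ₁ x).PosSemidef)
    (Λ₂ : Fin k₂ → Matrix (B₂ × Fin r₂) (B₂ × Fin r₂) ℂ) {σ : Matrix E E ℂ}
    (hσ : σ ∈ densityOps E) :
    ∃ σ₁ ∈ densityOps E₁, ∃ τ : Fin k₁ → Matrix E₂ E₂ ℂ, (∀ x, τ x ∈ densityOps E₂) ∧
      ∀ x y, ((Λ₁ x ⊗ₖ Λ₂ y).submatrix (pairEquiv eB r₁ r₂) (pairEquiv eB r₁ r₂) *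
          jammedOutput N
            ((ρ₁ ⊗ₖ ρ₂).submatrix (pairEquiv eA r₁ r₂) (pairEquiv eA r₁ r₂)) σ).trace.re =
        outcome Λ₁ (jammedOutput N₁ ρ₁ σ₁) x *
          outcome Λ₂ (jammedOutput N₂ ρ₂ (τ x)) y := by
  have hS : σ.submatrix eE.symm eE.symm ∈ densityOps (E₁ × E₂) := by
    refine ⟨hσ.1.submatrix _, ?_⟩
    rw [← hσ.2]
    exact eE.symm.sum_comp fun e => σ e e
  have hσS : σ = (σ.submatrix eE.symm eE.symm).submatrix eE eE := by simp
  have hpos : ∀ x Y, Y.PosSemidef → 0 ≤ effectFunctional N₁ ρ₁ (Λ₁ x) Y := fun x Y hY =>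
    trace_mul_nonneg (hΛ₁ x) (jammedOutput_posSemidef hN₁ hρ₁ hY)
  choose τ hτ hslice using fun x => exists_eq_smul_densityOps (slice_posSemidef (hpos x) hS.1)
  refine ⟨_, partialTrace_mem_densityOps hS, τ, hτ, fun x y => ?_⟩
  conv_lhs => rw [hσS, h.trace_mul, hslice x]
  change outcome Λ₂ (jammedOutput N₂ ρ₂ _) y = _
  rw [outcome_jammedOutput_smul, Pi.smul_apply, smul_eq_mul, trace_slice]
  rfl

/-- Super-additivity: the product of near-optimal inputs and of jammer-independent measurements for
the factors is an input and a measurement for the product channel. -/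
theorem minimaxDiv_add_le [Nonempty E₁] [Nonempty E₂] {α : ℝ} (hα : 0 < α)
    (hN : Factors eA eE eB N N₁ N₂) (hM : Factors eA eE eB M M₁ M₂)
    (hN₁ : IsCPTP N₁) (hM₁ : IsCP M₁) (hN₂ : IsCPTP N₂) (hM₂ : IsCP M₂) :
    minimaxDiv α N₁ M₁ + minimaxDiv α N₂ M₂ ≤ minimaxDiv α N M := by
  refine EReal.add_le_of_forall_lt fun c hc d hd => ?_
  induction c with
  | bot => simp
  | top => exact absurd hc not_top_lt
  | coe c =>
  induction d with
  | bot => simp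
  | top => exact absurd hd not_top_lt
  | coe d =>
  obtain ⟨r₁, ρ₁, hρ₁, hc⟩ : ∃ r, ∃ ρ ∈ densityOps (A₁ × Fin r), (c : EReal) <
      ⨅ (σ ∈ densityOps E₁) (ω ∈ densityOps E₁), measuredRenyi α
        (jammedOutput N₁ ρ σ) (jammedOutput M₁ ρ ω) := by
    simpa only [minimaxDiv, lt_iSup_iff, exists_prop] using hc
  obtain ⟨r₂, ρ₂, hρ₂, hd⟩ : ∃ r, ∃ ρ ∈ densityOps (A₂ × Fin r), (d : EReal) <
      ⨅ (σ ∈ densityOps E₂) (ω ∈ densityOps E₂), measuredRenyi α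
        (jammedOutput N₂ ρ σ) (jammedOutput M₂ ρ ω) := by
    simpa only [minimaxDiv, lt_iSup_iff, exists_prop] using hd
  obtain ⟨k₁, Λ₁, hΛ₁, hc⟩ := exists_povm_of_lt_iInf hα hN₁ hM₁ hρ₁ hc
  obtain ⟨k₂, Λ₂, hΛ₂, hd⟩ := exists_povm_of_lt_iInf hα hN₂ hM₂ hρ₂ hd
  have hρ : (ρ₁ ⊗ₖ ρ₂).submatrix (pairEquiv eA r₁ r₂) (pairEquiv eA r₁ r₂) ∈
      densityOps (A × Fin (r₁ * r₂)) := by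
    refine ⟨(hρ₁.1.kronecker hρ₂.1).submatrix _, ?_⟩
    have : (ρ₁ ⊗ₖ ρ₂).trace = 1 := by rw [Matrix.trace_kronecker, hρ₁.2, hρ₂.2, one_mul]
    rw [← this]
    exact (pairEquiv eA r₁ r₂).sum_comp fun z => (ρ₁ ⊗ₖ ρ₂) z z
  refine le_iSup_of_le (r₁ * r₂)
    (le_iSup₂_of_le _ hρ (le_iInf₂ fun σ hσ => le_iInf₂ fun ω hω => ?_))
  obtain ⟨σ₁, hσ₁, τ, hτ, hP⟩ := hN.exists_conditional hN₁.1 hρ₁.1 ρ₂ hΛ₁.1 Λ₂ hσ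
  obtain ⟨ω₁, hω₁, υ, hυ, hQ⟩ := hM.exists_conditional hM₁ hρ₁.1 ρ₂ hΛ₁.1 Λ₂ hω
  have hΛ := IsPOVM.reindex (Γ := fun z : Fin k₁ × Fin k₂ => Λ₁ z.1 ⊗ₖ Λ₂ z.2)
    (fun z => (hΛ₁.1 z.1).kronecker (hΛ₂.1 z.2)) (by
      rw [Fintype.sum_prod_type]
      ext a b
      have h1 := congrFun (congrFun hΛ₁.2 a.1) b.1
      have h2 := congrFun (congrFun hΛ₂.2 a.2) b.2
      rw [Matrix.sum_apply] at h1 h2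
      simp only [Matrix.sum_apply, Matrix.kroneckerMap_apply, ← Finset.mul_sum, ← Finset.sum_mul,
        h1, h2]
      exact congrFun (congrFun (Matrix.one_kronecker_one (α := ℂ)) a) b)
    (pairEquiv eB r₁ r₂) finProdFinEquiv.symm
  refine le_iSup_of_le (k₁ * k₂) (le_iSup₂_of_le _ hΛ ?_)
  have key := add_le_renyiDiv_of_conditional hα
    (P := outcome Λ₁ (jammedOutput N₁ ρ₁ σ₁))
    (Q := outcome Λ₁ (jammedOutput M₁ ρ₁ ω₁))
    (P' := fun x => outcome Λ₂ (jammedOutput N₂ ρ₂ (τ x)))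
    (Q' := fun x => outcome Λ₂ (jammedOutput M₂ ρ₂ (υ x)))
    (hΛ₁.outcome_nonneg (jammedOutput_posSemidef hN₁.1 hρ₁.1 hσ₁.1))
    (hΛ₁.outcome_nonneg (jammedOutput_posSemidef hM₁ hρ₁.1 hω₁.1))
    (by rw [hΛ₁.sum_outcome, trace_jammedOutput hN₁.2, hρ₁.2, hσ₁.2]; simp)
    (fun x => hΛ₂.outcome_nonneg (jammedOutput_posSemidef hN₂.1 hρ₂.1 (hτ x).1))
    (fun x => hΛ₂.outcome_nonneg (jammedOutput_posSemidef hM₂ hρ₂.1 (hυ x).1))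
    (fun x => by rw [hΛ₂.sum_outcome, trace_jammedOutput hN₂.2, hρ₂.2, (hτ x).2]; simp)
    (hc σ₁ hσ₁ ω₁ hω₁) (fun x => hd _ (hτ x) _ (hυ x))
  rw [← EReal.coe_add]
  refine key.trans_eq ?_
  rw [← renyiDiv_comp_equiv α (finProdFinEquiv (m := k₁) (n := k₂)).symm]
  congr 1
  · ext i
    exact (hP _ _).symm
  · ext i
    exact (hQ _ _).symm

theorem factors_jammerTensor (N₁ : Matrix (A₁ × E₁) (A₁ × E₁) ℂ →ₗ[ℂ] Matrix B₁ B₁ ℂ)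
    (N₂ : Matrix (A₂ × E₂) (A₂ × E₂) ℂ →ₗ[ℂ] Matrix B₂ B₂ ℂ) :
    Factors (Equiv.refl _) (Equiv.refl _) (Equiv.refl _) (jammerTensor N₁ N₂) N₁ N₂ := by
  intro X₁ X₂ Y₁ Y₂
  simpa using jammerTensor_kronecker N₁ N₂ X₁ X₂ Y₁ Y₂

end Factor

/-! ### Complete positivity and tensor powers -/

section Gram

variable {m n : Type*} [Fintype m] [DecidableEq m] [Fintype n] [DecidableEq n]

theorem apply_eq_sum_single (Φ : Matrix m m ℂ →ₗ[ℂ] Matrix n n ℂ) (Z : Matrix m m ℂ) (b b' : n) :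
    Φ Z b b' = ∑ p, ∑ q, Z p q * Φ (Matrix.single p q 1) b b' := by
  conv_lhs => rw [Matrix.matrix_eq_sum_single Z]
  simp only [map_sum, Matrix.sum_apply]
  refine Finset.sum_congr rfl fun p _ => Finset.sum_congr rfl fun q _ => ?_
  have : Matrix.single p q (Z p q) = Z p q • Matrix.single p q (1 : ℂ) := by
    simp [Matrix.smul_single]
  rw [this, map_smul, Matrix.smul_apply, smul_eq_mul]

/-- If the Choi matrix of `Φ` is a Gram matrix, then `Φ` is completely positive: the `G j` are the
adjoints of Kraus operators of `Φ`. -/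
theorem isCP_of_gram {J : Type*} [Fintype J] (Φ : Matrix m m ℂ →ₗ[ℂ] Matrix n n ℂ)
    (G : J → m → n → ℂ)
    (h : ∀ a a' b b', Φ (Matrix.single a a' 1) b b' = ∑ j, star (G j a b) * G j a' b') :
    IsCP Φ := by
  rw [isCP_iff]
  intro k X hX
  let K : J → Matrix (m × Fin k) (n × Fin k) ℂ := fun j =>
    Matrix.of fun x y => if x.2 = y.2 then G j x.1 y.1 else 0
  have : tensorMap Φ LinearMap.id X = ∑ j, (K j)ᴴ * X * K j := by
    ext x y
    rw [tensorMap_id_apply, apply_eq_sum_single Φ]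
    simp only [K, h, Matrix.sum_apply, Matrix.mul_apply,
      Matrix.conjTranspose_apply, Matrix.of_apply, Fintype.sum_prod_type, apply_ite star, star_zero,
      ite_mul, zero_mul, mul_ite, mul_zero, Finset.sum_ite_eq', Finset.mem_univ, if_true,
      Finset.mul_sum, Finset.sum_mul]
    rw [Finset.sum_comm]
    symm
    rw [Finset.sum_comm]
    refine Finset.sum_congr rfl fun a' _ => ?_
    rw [Finset.sum_comm]
    refine Finset.sum_congr rfl fun a _ => Finset.sum_congr rfl fun j _ => ?_
    ring
  rw [this]
  exact Matrix.posSemidef_sum _ fun j _ => hX.conjTranspose_mul_mul_same _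

/-- The Choi matrix of a completely positive map is a Gram matrix, being the image of a maximally
entangled operator `v vᴴ`. -/
theorem IsCP.exists_gram {Φ : Matrix m m ℂ →ₗ[ℂ] Matrix n n ℂ} (hΦ : IsCP Φ) :
    ∃ G : n × Fin (Fintype.card m) → m → n → ℂ,
      ∀ a a' b b', Φ (Matrix.single a a' 1) b b' = ∑ j, star (G j a b) * G j a' b' := by
  let e := Fintype.equivFin m
  let v : m × Fin (Fintype.card m) → ℂ := fun x => if e x.1 = x.2 then 1 else 0
  obtain ⟨G, hG⟩ := exists_eq_conjTranspose_mul_self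
    ((isCP_iff Φ).1 hΦ _ _ (Matrix.posSemidef_vecMulVec_self_star v))
  refine ⟨fun j a b => G j (b, e a), fun a a' b b' => ?_⟩
  have h := congrFun (congrFun hG (b, e a)) (b', e a')
  rw [tensorMap_id_apply, Matrix.mul_apply] at h
  have hs : (Matrix.of fun c c' => Matrix.vecMulVec v (star v) (c, (b, e a).2) (c', (b', e a').2)) =
      Matrix.single a a' (1 : ℂ) := by
    ext c c'
    simp only [v, Matrix.of_apply, Matrix.vecMulVec_apply, Pi.star_apply, Matrix.single_apply,
      e.injective.eq_iff, apply_ite star, star_one, star_zero, mul_ite, mul_one, mul_zero]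
    by_cases h1 : a = c <;> by_cases h2 : a' = c' <;>
      simp [h1, h2, eq_comm (a := c), eq_comm (a := c')]
  rw [hs] at h
  exact h

end Gram

section Pow

variable {A E B : Type*} [Fintype A] [DecidableEq A] [Fintype E] [DecidableEq E] [Fintype B]
  [DecidableEq B]

theorem jammerPow_apply (N : Matrix (A × E) (A × E) ℂ →ₗ[ℂ] Matrix B B ℂ) (k : ℕ)
    (Z : Matrix ((Fin k → A) × (Fin k → E)) ((Fin k → A) × (Fin k → E)) ℂ) (b b' : Fin k → B) :
    jammerPow N k Z b b' = ∑ p, ∑ p', Z p p' *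
      ∏ i, N (Matrix.single (p.1 i, p.2 i) (p'.1 i, p'.2 i) 1) (b i) (b' i) := by
  rw [← (Equiv.arrowProdEquivProdArrow (Fin k) (fun _ => A) (fun _ => E)).sum_comp]
  simp_rw [← (Equiv.arrowProdEquivProdArrow (Fin k) (fun _ => A) (fun _ => E)).sum_comp]
  rfl

theorem jammerPow_single (N : Matrix (A × E) (A × E) ℂ →ₗ[ℂ] Matrix B B ℂ) (k : ℕ)
    (p p' : (Fin k → A) × (Fin k → E)) (b b' : Fin k → B) :
    jammerPow N k (Matrix.single p p' 1) b b' =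
      ∏ i, N (Matrix.single (p.1 i, p.2 i) (p'.1 i, p'.2 i) 1) (b i) (b' i) := by
  rw [jammerPow_apply, Finset.sum_eq_single p, Finset.sum_eq_single p']
  · simp
  · intro q _ hq
    simp [hq.symm]
  · simp
  · intro q _ hq
    simp [hq.symm]
  · simp

theorem IsCP.jammerPow {N : Matrix (A × E) (A × E) ℂ →ₗ[ℂ] Matrix B B ℂ} (hN : IsCP N) (k : ℕ) :
    IsCP (jammerPow N k) := by
  obtain ⟨G, hG⟩ := hN.exists_gram
  refine isCP_of_gram (J := Fin k → B × Fin (Fintype.card (A × E))) _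
    (fun j p b => ∏ i, G (j i) (p.1 i, p.2 i) (b i)) fun p p' b b' => ?_
  simp only [jammerPow_single, hG, Finset.prod_univ_sum, Fintype.piFinset_univ,
    Finset.prod_mul_distrib, star_prod]

theorem IsCPTP.jammerPow {N : Matrix (A × E) (A × E) ℂ →ₗ[ℂ] Matrix B B ℂ} (hN : IsCPTP N)
    (k : ℕ) : IsCPTP (jammerPow N k) := by
  refine ⟨hN.1.jammerPow k, fun X => ?_⟩
  have htr : ∀ p p' : (Fin k → A) × (Fin k → E), ∑ b : Fin k → B,
      ∏ i, N (Matrix.single (p.1 i, p.2 i) (p'.1 i, p'.2 i) 1) (b i) (b i) =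
        if p = p' then 1 else 0 := by
    intro p p'
    have h1 : ∀ x x' : A × E, ∑ b, N (Matrix.single x x' 1) b b = if x = x' then 1 else 0 := by
      intro x x'
      refine (hN.2 _).trans ?_
      split_ifs with hx
      · rw [hx, Matrix.trace_single_eq_same]
      · exact Matrix.trace_single_eq_of_ne _ _ _ hx
    rw [← Fintype.piFinset_univ, ← Finset.prod_univ_sum (fun _ : Fin k => Finset.univ)
      (fun i b => N (Matrix.single (p.1 i, p.2 i) (p'.1 i, p'.2 i) 1) b b)]
    simp only [h1, Finset.prod_ite_zero, Finset.prod_const_one, Finset.mem_univ, true_imp_iff,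
      Prod.ext_iff, funext_iff, forall_and]
  simp only [Matrix.trace, Matrix.diag, jammerPow_apply]
  rw [Finset.sum_comm]
  refine Finset.sum_congr rfl fun p _ => ?_
  rw [Finset.sum_comm]
  simp only [← Finset.mul_sum, htr, mul_ite, mul_one, mul_zero, Finset.sum_ite_eq, Finset.mem_univ,
    if_true]

theorem factors_jammerPow (N : Matrix (A × E) (A × E) ℂ →ₗ[ℂ] Matrix B B ℂ) (k l : ℕ) :
    Factors (Fin.appendEquiv k l).symm (Fin.appendEquiv k l).symm (Fin.appendEquiv k l).symm
      (jammerPow N (k + l)) (jammerPow N k) (jammerPow N l) := by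
  intro X₁ X₂ Y₁ Y₂
  let e : ((Fin k → A) × (Fin k → E)) × ((Fin l → A) × (Fin l → E)) ≃
      (Fin (k + l) → A) × (Fin (k + l) → E) :=
    (Equiv.prodProdProdComm _ _ _ _).trans
      ((Fin.appendEquiv k l).prodCongr (Fin.appendEquiv k l))
  ext b b'
  rw [Matrix.submatrix_apply, Matrix.kroneckerMap_apply]
  simp only [jammerPow_apply]
  rw [← e.sum_comp]
  simp_rw [← e.sum_comp]
  rw [Fintype.sum_prod_type, Finset.sum_mul_sum]
  refine Finset.sum_congr rfl fun p _ => Finset.sum_congr rfl fun q _ => ?_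
  rw [Fintype.sum_prod_type, Finset.sum_mul_sum]
  refine Finset.sum_congr rfl fun p' _ => Finset.sum_congr rfl fun q' _ => ?_
  have hb : ∀ c : Fin (k + l) → B,
      ((Fin.appendEquiv k l).symm c).1 = fun i => c (Fin.castAdd l i) := fun c => rfl
  have hb' : ∀ c : Fin (k + l) → B,
      ((Fin.appendEquiv k l).symm c).2 = fun i => c (Fin.natAdd k i) := fun c => rfl
  have he : ∀ p q, e (p, q) = (Fin.append p.1 q.1, Fin.append p.2 q.2) := fun p q => rfl
  have hA : ∀ (u : Fin k → A) (v : Fin l → A),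
      (Fin.appendEquiv k l).symm (Fin.append u v) = (u, v) :=
    fun u v => (Fin.appendEquiv k l).symm_apply_apply (u, v)
  have hE : ∀ (u : Fin k → E) (v : Fin l → E),
      (Fin.appendEquiv k l).symm (Fin.append u v) = (u, v) :=
    fun u v => (Fin.appendEquiv k l).symm_apply_apply (u, v)
  simp only [Matrix.kroneckerMap_apply, Matrix.submatrix_apply, he, hA, hE, hb, hb',
    Fin.prod_univ_add, Fin.append_left, Fin.append_right]
  ring

end Pow

/-! ### Finiteness from below -/

/-- With a single outcome the divergence is `-log (Q 0)`, or infinite for `Q 0 = 0`; in the latter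
case the bound holds whatever the junk value of `log C`. -/
theorem neg_log_le_renyiDiv (α : ℝ) {P Q : Fin 1 → ℝ} {C : ℝ} (hP : P 0 = 1) (hQ : 0 ≤ Q 0)
    (hC : Q 0 ≤ C) : ((-Real.log C : ℝ) : EReal) ≤ renyiDiv α P Q := by
  unfold renyiDiv
  rcases hQ.eq_or_lt with h0 | h0
  · simp [Fin.forall_fin_one, Fin.exists_fin_one, hP, ← h0]
  · have hlog : -Real.log C ≤ -Real.log (Q 0) := neg_le_neg (Real.log_le_log h0 hC)
    by_cases hα : α = 1
    · simpa [Fin.forall_fin_one, hP, h0.ne', hα] using hlog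
    · have hα' : α - 1 ≠ 0 := sub_ne_zero.2 hα
      have : (α - 1)⁻¹ * ((1 - α) * Real.log (Q 0)) = -Real.log (Q 0) := by
        field_simp
        ring
      simp only [hα, if_false, Fin.forall_fin_one, h0.ne', hP, false_imp_iff, or_true, if_true,
        Fin.sum_univ_one, Real.one_rpow, one_mul, Real.log_rpow h0, this, EReal.coe_le_coe_iff]
      exact hlog

/-- Already the trivial measurement gives a lower bound, as the trace of the output of `M` is
bounded over the compact set of jammer states. -/
theorem bot_lt_minimaxDiv {A E B : Type*} [Fintype A] [DecidableEq A] [Nonempty A] [Fintype E]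
    [DecidableEq E] [Fintype B] [DecidableEq B] (α : ℝ)
    {N M : Matrix (A × E) (A × E) ℂ →ₗ[ℂ] Matrix B B ℂ} (hN : IsCPTP N) (hM : IsCP M) :
    ⊥ < minimaxDiv α N M := by
  obtain ⟨ρ, hρ⟩ := densityOps_nonempty (n := A × Fin 1)
  have hΛ : IsPOVM (fun _ : Fin 1 => (1 : Matrix (B × Fin 1) (B × Fin 1) ℂ)) :=
    ⟨fun _ => Matrix.PosSemidef.one, by simp⟩
  obtain ⟨C, hC⟩ := isCompact_densityOps.bddAbove_image (K := densityOps E)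
    (continuous_outcome_jammedOutput M ρ (fun _ : Fin 1 => 1) 0).continuousOn
  refine (EReal.bot_lt_coe (-Real.log C)).trans_le (le_iSup_of_le 1 (le_iSup₂_of_le ρ hρ
    (le_iInf₂ fun σ hσ => le_iInf₂ fun ω hω => le_iSup_of_le 1 (le_iSup₂_of_le _ hΛ ?_))))
  refine neg_log_le_renyiDiv α ?_
    (hΛ.outcome_nonneg (jammedOutput_posSemidef hM hρ.1 hω.1) 0) (hC ⟨ω, hω, rfl⟩)
  have := hΛ.sum_outcome (jammedOutput N ρ σ)
  rw [Fin.sum_univ_one, trace_jammedOutput hN.2, hρ.2, hσ.2] at this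
  simpa using this

/-! ### Superadditive sequences of extended reals -/

open Filter in
/-- Fekete's lemma for superadditive sequences in `(-∞, ∞]`. -/
theorem tendsto_inv_mul_of_superadditive {u : ℕ → EReal} (hbot : ∀ n, ⊥ < u n)
    (hadd : ∀ m n, u m + u n ≤ u (m + n)) :
    Tendsto (fun n : ℕ => (((1 / (n : ℝ) : ℝ)) : EReal) * u n) atTop
      (nhds (⨆ (n : ℕ) (_ : 1 ≤ n), (((1 / (n : ℝ) : ℝ)) : EReal) * u n)) := by
  have hmul : ∀ {n : ℕ}, 1 ≤ n → ∀ x : ℝ, ∀ y : EReal,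
      ((x : EReal) < ((1 / (n : ℝ) : ℝ) : EReal) * y ↔ ((n * x : ℝ) : EReal) < y) := by
    intro n hn x y
    have hn' : (0 : ℝ) < n := by exact_mod_cast hn
    induction y with
    | bot =>
      rw [EReal.coe_mul_bot_of_pos (one_div_pos.2 hn')]
      exact iff_of_false not_lt_bot not_lt_bot
    | top =>
      rw [EReal.coe_mul_top_of_pos (one_div_pos.2 hn')]
      exact iff_of_true (EReal.coe_lt_top _) (EReal.coe_lt_top _)
    | coe y =>
      rw [← EReal.coe_mul, EReal.coe_lt_coe_iff, EReal.coe_lt_coe_iff, one_div_mul_eq_div,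
        lt_div_iff₀ hn', mul_comm]
  rw [tendsto_order]
  constructor
  · intro a ha
    obtain ⟨c, hac, hc⟩ := EReal.lt_iff_exists_real_btwn.1 ha
    simp only [lt_iSup_iff] at hc
    obtain ⟨m, hm, hc⟩ := hc
    obtain ⟨d, hcd, hd⟩ := EReal.lt_iff_exists_real_btwn.1 hc
    rw [hmul hm] at hd
    rw [EReal.coe_lt_coe_iff] at hcd
    -- Write `n = (n / m) m + n % m`; the remainders contribute at least `-b`.
    choose β hβ using fun r => EReal.lt_iff_exists_real_btwn.1 (hbot r)
    let b : ℝ := ∑ r ∈ Finset.range m, |β r|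
    have hb : ∀ r < m, ((-b : ℝ) : EReal) ≤ u r := by
      intro r hr
      refine le_trans ?_ (hβ r).2.le
      rw [EReal.coe_le_coe_iff]
      have : |β r| ≤ b := Finset.single_le_sum (f := fun r => |β r|) (fun _ _ => abs_nonneg _)
        (Finset.mem_range.2 hr)
      linarith [neg_abs_le (β r)]
    have hq : ∀ q r : ℕ, r < m → ((q * (m * d) - b : ℝ) : EReal) ≤ u (q * m + r) := by
      intro q r hr
      induction q with
      | zero => simpa using hb r hr
      | succ q ih =>
        have h1 := (add_le_add hd.le ih).trans (hadd _ _)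
        rw [← EReal.coe_add] at h1
        convert h1 using 2
        · push_cast
          ring
        · ring
    have hm' : (0 : ℝ) < m := by exact_mod_cast hm
    have hev : ∀ᶠ n : ℕ in atTop, m * |d| + b < n * (d - c) := by
      have : Tendsto (fun n : ℕ => (n : ℝ) * (d - c)) atTop atTop :=
        tendsto_natCast_atTop_atTop.atTop_mul_const (sub_pos.2 hcd)
      exact this.eventually_gt_atTop _
    filter_upwards [hev, eventually_ge_atTop 1] with n hn hn1
    refine hac.trans ((hmul hn1 _ _).2 (lt_of_lt_of_le ?_
      ((hq (n / m) (n % m) (Nat.mod_lt _ hm)).trans_eq (by rw [Nat.div_add_mod']))))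
    rw [EReal.coe_lt_coe_iff]
    have hr : ((n % m : ℕ) : ℝ) ≤ m := by exact_mod_cast (Nat.mod_lt n hm).le
    have hdiv : ((n / m : ℕ) : ℝ) * m + ((n % m : ℕ) : ℝ) = n := by
      exact_mod_cast Nat.div_add_mod' n m
    have h1 : ((n % m : ℕ) : ℝ) * d ≤ m * |d| :=
      (mul_le_mul_of_nonneg_left (le_abs_self d) (Nat.cast_nonneg _)).trans
        (mul_le_mul_of_nonneg_right hr (abs_nonneg d))
    have h2 : ((n / m : ℕ) : ℝ) * (m * d) = n * d - ((n % m : ℕ) : ℝ) * d := by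
      rw [← hdiv]
      ring
    linarith
  · intro a ha
    filter_upwards [eventually_ge_atTop 1] with n hn
    exact (le_iSup₂_of_le n hn le_rfl).trans_lt ha

end JammerChannel

theorem mainTheorem6 (α : ℝ) (hα : 0 < α) :
    (∀ (A₁ E₁ B₁ A₂ E₂ B₂ : Type*)
      [Fintype A₁] [DecidableEq A₁] [Nonempty A₁] [Fintype E₁] [DecidableEq E₁] [Nonempty E₁]
      [Fintype B₁] [DecidableEq B₁] [Nonempty B₁] [Fintype A₂] [DecidableEq A₂] [Nonempty A₂]
      [Fintype E₂] [DecidableEq E₂] [Nonempty E₂] [Fintype B₂] [DecidableEq B₂] [Nonempty B₂]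
      (N₁ M₁ : Matrix (A₁ × E₁) (A₁ × E₁) ℂ →ₗ[ℂ] Matrix B₁ B₁ ℂ)
      (N₂ M₂ : Matrix (A₂ × E₂) (A₂ × E₂) ℂ →ₗ[ℂ] Matrix B₂ B₂ ℂ),
      JammerChannel.IsCPTP N₁ → JammerChannel.IsCP M₁ →
      JammerChannel.IsCPTP N₂ → JammerChannel.IsCP M₂ →
        JammerChannel.minimaxDiv α N₁ M₁ + JammerChannel.minimaxDiv α N₂ M₂ ≤
          JammerChannel.minimaxDiv α (JammerChannel.jammerTensor N₁ N₂)
            (JammerChannel.jammerTensor M₁ M₂)) ∧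
    (∀ (A E B : Type*)
      [Fintype A] [DecidableEq A] [Nonempty A] [Fintype E] [DecidableEq E] [Nonempty E]
      [Fintype B] [DecidableEq B] [Nonempty B]
      (N M : Matrix (A × E) (A × E) ℂ →ₗ[ℂ] Matrix B B ℂ),
      JammerChannel.IsCPTP N → JammerChannel.IsCP M →
        Filter.Tendsto
          (fun n : ℕ => (((1 / (n : ℝ) : ℝ)) : EReal) *
            JammerChannel.minimaxDiv α (JammerChannel.jammerPow N n) (JammerChannel.jammerPow M n))
          Filter.atTop
          (nhds (⨆ (n : ℕ) (_ : 1 ≤ n), (((1 / (n : ℝ) : ℝ)) : EReal) *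
            JammerChannel.minimaxDiv α (JammerChannel.jammerPow N n)
              (JammerChannel.jammerPow M n)))) := by
  refine ⟨?_, ?_⟩
  · intro A₁ E₁ B₁ A₂ E₂ B₂ _ _ _ _ _ _ _ _ _ _ _ _ _ _ _ _ _ _ N₁ M₁ N₂ M₂ hN₁ hM₁ hN₂ hM₂
    exact JammerChannel.minimaxDiv_add_le hα (JammerChannel.factors_jammerTensor N₁ N₂)
      (JammerChannel.factors_jammerTensor M₁ M₂) hN₁ hM₁ hN₂ hM₂
  · intro A E B _ _ _ _ _ _ _ _ _ N M hN hM
    exact JammerChannel.tendsto_inv_mul_of_superadditive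
      (fun n => JammerChannel.bot_lt_minimaxDiv α (hN.jammerPow n) (hM.jammerPow n))
      (fun k l => JammerChannel.minimaxDiv_add_le hα (JammerChannel.factors_jammerPow N k l)
        (JammerChannel.factors_jammerPow M k l) (hN.jammerPow k) (hM.jammerPow k) (hN.jammerPow l)
        (hM.jammerPow l))
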